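/- Let $n$ be a prime. For $a\in\mathbb{Z}_n$ and an integer $c\ge 0$ put $AP(a,c)=\{0,a,2a,\dots,ca\}\subset\mathbb{Z}_n$, an arithmetic progression of length $c$. A sumset $\sum_{i\in\mathbb{Z}_n}AP(i,A[i])$ is given by its array of lengths $A:\mathbb{Z}_n\to\mathbb{Z}_{\ge 0}$. We say that some $n/k$ values have total length at least $n$ in $A$ if there is a set $I\subset\mathbb{Z}_n\setminus\{0\}$ with $|I|\le n/k$ and $\sum_{i\in I}A[i]\ge n$. A construction of $x\in\mathbb{Z}_n$ in $A$ is a choice of integers $0\le m_i\le A[i]$ with $\sum_i m_i\,i=x$. The operations on $A$ are the following. - (Drop) Decrease any of the lengths $A[i]$. - (Operation 1) If $ya=xb$ with integers $y>x\ge 0$, replace $AP(a,y)+AP(b,x)$ by $AP(a,2y)$, with shift $0$. - (Operation 2) If $a,b\ne 0$, $va=wb$ with $v,w\in\{1,\dots,n-1\}$ coprime, $t\ge v$ and $s\ge w$, replace $AP(a,t)+AP(b,s)$ by $AP(z,u)$, where $z=a/w=b/v$ and $u=tw+sv-2(vw-v-w+1)$, with shift $(vw-v-w+1)z$. Here the replaced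 progressions are taken out of the lengths available in $A$ (progressions with the same difference are split and merged freely), and the total shift of a sequence of operations is the sum of the shifts. Theorem (Growth step). There are two fixed programs $P$, $R$ for a word RAM (unit cost for arithmetic, comparison and memory access, on words of $O(\log(n+\sum_i A[i]))$ bits) and an absolute constant $C$ such that the following holds for every prime $n$, every real $k\ge 1000$ with $k^{4/3}\le n$, and every array of lengths $A$ in which some $n/k$ values have total length at least $n$. On input $n$ and $A$, the program $P$ outputs within $Cn$ steps an array of lengths $A'$ and a shift $g\in\mathbb{Z}_n$ such that 1. $A'$ is obtained from $A$ by a finite sequence of the operations above, with total shift $g$; 2. the inclusion $g+\sum_i AP(i,A'[i])\subset\sum_i AP(i,A[i])$ holds constructively: from the memory left by $P$ and any construction of any $x\in\mathbb{Z}_n$ in $A'$, the program $R$ computes within $Cn$ steps a construction of $x+g$ in $A$; 3. for some real $k'\ge k^{4/3}$, some $n/k'$ values have total length at least $n$ in $A'$. -/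

import Mathlib

/-! ### A word RAM: structured programs over registers and arrays, with a step count -/

namespace WordRAM

/-- The arithmetic and comparison instructions. Subtraction is truncated, division is the integer
division, and comparisons return `1` or `0`. -/
inductive BinOp where
  | add | sub | mul | div | mod | lt | eq

/-- The result of an instruction on two words. -/
def BinOp.eval : BinOp → ℕ → ℕ → ℕ
  | .add, x, y => x + y
  | .sub, x, y => x - y
  | .mul, x, y => x * y
  | .div, x, y => x / y
  | .mod, x, y => x % y
  | .lt, x, y => if x < y then 1 else 0
  | .eq, x, y => if x = y then 1 else 0

/-- The memory: registers `reg x` and cells `arr a i` (cell `i` of array `a`). -/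
structure Store where
  reg : ℕ → ℕ
  arr : ℕ → ℕ → ℕ

/-- Expressions: constants, registers, array cells at a computed address, and instructions. -/
inductive Expr where
  | const (c : ℕ)
  | reg (x : ℕ)
  | cell (a : ℕ) (i : Expr)
  | bin (o : BinOp) (e f : Expr)

/-- The value of an expression. -/
def Expr.eval (σ : Store) : Expr → ℕ
  | .const c => c
  | .reg x => σ.reg x
  | .cell a i => σ.arr a (i.eval σ)
  | .bin o e f => o.eval (e.eval σ) (f.eval σ)

/-- No overflow: every value met in evaluating the expression is a word, that is, less than `B`. -/
def Expr.Fits (B : ℕ) (σ : Store) : Expr → Prop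
  | .const c => c < B
  | .reg x => σ.reg x < B
  | .cell a i => i.Fits B σ ∧ σ.arr a (i.eval σ) < B
  | .bin o e f => e.Fits B σ ∧ f.Fits B σ ∧ o.eval (e.eval σ) (f.eval σ) < B

/-- The number of elementary steps that evaluating an expression takes. -/
def Expr.cost : Expr → ℕ
  | .const _ => 1
  | .reg _ => 1
  | .cell _ i => i.cost + 1
  | .bin _ e f => e.cost + f.cost + 1

/-- Programs. A program is a finite text, so it uses finitely many registers and arrays, and it
does not depend on the input. -/
inductive Prog where
  | skip
  | set (x : ℕ) (e : Expr)
  | store (a : ℕ) (i e : Expr)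
  | seq (p q : Prog)
  | ite (e : Expr) (p q : Prog)
  | loop (e : Expr) (p : Prog)

/-- `Exec B p σ τ t`: on a machine whose words hold the numbers less than `B`, the program `p`
started with memory `σ` halts with memory `τ` after exactly `t` elementary steps, without any
overflow. A condition counts as true when it is not zero. -/
inductive Exec (B : ℕ) : Prog → Store → Store → ℕ → Prop
  | skip (σ : Store) : Exec B .skip σ σ 1
  | set (σ : Store) (x : ℕ) (e : Expr) (he : e.Fits B σ) :
      Exec B (.set x e) σ { σ with reg := Function.update σ.reg x (e.eval σ) } (e.cost + 1)
  | store (σ : Store) (a : ℕ) (i e : Expr) (hi : i.Fits B σ) (he : e.Fits B σ) :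
      Exec B (.store a i e) σ
        { σ with arr := Function.update σ.arr a
                    (Function.update (σ.arr a) (i.eval σ) (e.eval σ)) }
        (i.cost + e.cost + 1)
  | seq {p q : Prog} {σ τ υ : Store} {s t : ℕ} (hp : Exec B p σ τ s) (hq : Exec B q τ υ t) :
      Exec B (.seq p q) σ υ (s + t)
  | iteTrue {e : Expr} {p q : Prog} {σ τ : Store} {t : ℕ} (he : e.Fits B σ)
      (h : e.eval σ ≠ 0) (hp : Exec B p σ τ t) : Exec B (.ite e p q) σ τ (e.cost + 1 + t)
  | iteFalse {e : Expr} {p q : Prog} {σ τ : Store} {t : ℕ} (he : e.Fits B σ)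
      (h : e.eval σ = 0) (hq : Exec B q σ τ t) : Exec B (.ite e p q) σ τ (e.cost + 1 + t)
  | loopDone {e : Expr} {p : Prog} {σ : Store} (he : e.Fits B σ) (h : e.eval σ = 0) :
      Exec B (.loop e p) σ σ (e.cost + 1)
  | loopStep {e : Expr} {p : Prog} {σ τ υ : Store} {s t : ℕ} (he : e.Fits B σ)
      (h : e.eval σ ≠ 0) (hp : Exec B p σ τ s) (hl : Exec B (.loop e p) τ υ t) :
      Exec B (.loop e p) σ υ (e.cost + 1 + s + t)

end WordRAM

/-! ### Sumsets of arithmetic progressions and the operations on them -/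

namespace APSum

/-- A sumset `∑ i, AP(i, A i)` in `ZMod n`, where `AP(i, c) = {0, i, 2i, …, ci}` has length `c`,
given by the array of its lengths. Progressions with the same difference are merged. -/
abbrev Lengths (n : ℕ) : Type := ZMod n → ℕ

/-- Some `n / k` values (at most `n / k` nonzero common differences) have total length
at least `n`. -/
def Concentrated (n : ℕ) (k : ℝ) (A : Lengths n) : Prop :=
  ∃ I : Finset (ZMod n), 0 ∉ I ∧ (I.card : ℝ) ≤ (n : ℝ) / k ∧ n ≤ ∑ i ∈ I, A i

/-- A construction of `x` in the sumset: from each progression `AP(i, A i)` an element `(m i) * i`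
with `m i ≤ A i` is chosen, and the chosen elements add up to `x`. -/
def IsConstruction {n : ℕ} [NeZero n] (A : Lengths n) (m : ZMod n → ℕ) (x : ZMod n) : Prop :=
  (∀ i, m i ≤ A i) ∧ ∑ i, (m i : ZMod n) * i = x

/-- `Op A A' c`: one operation turns the sumset `A` into `A'`, with shift `c`
(so that `c + ∑ AP(i, A' i) ⊆ ∑ AP(i, A i)`). -/
inductive Op {n : ℕ} (A : Lengths n) : Lengths n → ZMod n → Prop
  /-- Lengths may be dropped. -/
  | drop (A' : Lengths n) (h : A' ≤ A) : Op A A' 0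
  /-- If `y a = x b` and `y > x`, replace `AP(a, y) + AP(b, x)` by `AP(a, 2y)`. -/
  | op1 (a b : ZMod n) (x y : ℕ) (hab : (y : ZMod n) * a = (x : ZMod n) * b) (hxy : x < y)
      (hA : Pi.single a y + Pi.single b x ≤ A) :
      Op A (A - (Pi.single a y + Pi.single b x) + Pi.single a (2 * y)) 0
  /-- If `v a = w b` with `v`, `w` coprime in `[1, n - 1]`, `t ≥ v`, `s ≥ w` and
  `z = a / w = b / v`, replace `AP(a, t) + AP(b, s)` by `c + AP(z, u)`, where
  `u = t w + s v - 2 (v w - v - w + 1)` and `c = (v w - v - w + 1) z`. -/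
  | op2 (a b z : ZMod n) (v w t s u : ℕ) (ha : a ≠ 0) (hb : b ≠ 0)
      (hv : 1 ≤ v ∧ v < n) (hw : 1 ≤ w ∧ w < n) (hvw : Nat.Coprime v w)
      (hza : a = (w : ZMod n) * z) (hzb : b = (v : ZMod n) * z) (ht : v ≤ t) (hs : w ≤ s)
      (hu : u + 2 * ((v - 1) * (w - 1)) = t * w + s * v)
      (hA : Pi.single a t + Pi.single b s ≤ A) :
      Op A (A - (Pi.single a t + Pi.single b s) + Pi.single z u)
        (((v - 1) * (w - 1) : ℕ) * z)

/-- `Reach A A' g`: finitely many operations turn `A` into `A'`, with total shift `g`. -/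
inductive Reach {n : ℕ} (A : Lengths n) : Lengths n → ZMod n → Prop
  | refl : Reach A A 0
  | step {A' A'' : Lengths n} {g c : ZMod n} (h : Reach A A' g) (hop : Op A' A'' c) :
      Reach A A'' (g + c)

/-- The array with entries `f 0, f 1, …, f (n - 1)`, followed by zeros. -/
def table {n : ℕ} (f : ZMod n → ℕ) : ℕ → ℕ :=
  fun j => if j < n then f (j : ZMod n) else 0

/-- The initial memory: `n` in register `0`, the lengths in array `0`, zeros elsewhere. -/
def inputStore {n : ℕ} (A : Lengths n) : WordRAM.Store where
  reg := Function.update (fun _ => 0) 0 n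
  arr := Function.update (fun _ _ => 0) 0 (table A)

/-- The memory `σ` holds the new lengths `A'` in array `1` and the total shift in register `1`. -/
def Holds {n : ℕ} (σ : WordRAM.Store) (A' : Lengths n) (g : ZMod n) : Prop :=
  (∀ i : ZMod n, σ.arr 1 i.val = A' i) ∧ σ.reg 1 = g.val

/-- `Recovers B T R σ A A' g`: the program `R`, run on words less than `B`, turns the memory `σ`
and any construction of any `x` in the sumset `A'` (given in array `2`) into a construction of
`x + g` in the sumset `A` (left in array `3`), in at most `T` steps. Thus the inclusion
`g + ∑ AP(i, A' i) ⊆ ∑ AP(i, A i)` holds constructively. -/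
def Recovers {n : ℕ} [NeZero n] (B T : ℕ) (R : WordRAM.Prog) (σ : WordRAM.Store)
    (A A' : Lengths n) (g : ZMod n) : Prop :=
  ∀ (m' : ZMod n → ℕ) (x : ZMod n), IsConstruction A' m' x →
    ∃ (τ : WordRAM.Store) (t : ℕ),
      WordRAM.Exec B R { σ with arr := Function.update σ.arr 2 (table m') } τ t ∧ t ≤ T ∧
      IsConstruction A (fun i => τ.arr 3 i.val) (x + g)

end APSum

/-! The statement follows from something stronger: linear time suffices to merge until one
progression with nonzero difference has length at least `n`. That single difference witnesses
concentration with `k' = n`. Besides drops, only Operation 2 is used.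

The progressions are taken up one at a time, and the multiples `a, 2a, ...` of the current
difference are entered in a table of owners indexed by residues. Live entries are distinct nonzero
residues, so there are fewer than `n` of them (`State.Inv.sum_f_lt`). Since the input has total
length at least `n`, it cannot be entered completely without a collision `v * cur = w * b`. The
first collision of a pair has `v` and `w` coprime, for otherwise dividing by the gcd gives an
earlier one (`State.Inv.collision`). The two progressions are then merged, which gains length in
proportion to the entries that are thrown away (`merge_gain`). Hence a weighted sum of entries,
lengths and input position increases in every round. It is at most `8 * n` while the current length
is below `n`, so the number of rounds is linear.

For the converse direction the merges are logged and undone from the last to the first. Undoing one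
means writing a number as `q * w + r * v` with `q ≤ t` and `r ≤ s`, which is possible away from both
ends of the range and is found among `v` consecutive candidates (`exists_split`). Each `v` is
charged to the length gained by its merge, so the sum of all `v` is at most `5 * n` and the recovery
is linear as well. -/

namespace APSum

/-! ### A single merge: its gain in length and its inversion. -/

/-- The data of a merge (the second operation): `AP(w z, t) + AP(v z, s)` becomes an arithmetic
progression with difference `z`. -/
structure Merge (n : ℕ) where
  z : ZMod n
  v : ℕ
  w : ℕ
  t : ℕ
  s : ℕ

namespace Merge
variable {n : ℕ} (o : Merge n)

/-- The first common difference. -/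
def a : ZMod n := o.w * o.z

/-- The second common difference. -/
def b : ZMod n := o.v * o.z

/-- The length of the new progression. -/
def u : ℕ := o.t * o.w + o.s * o.v - 2 * ((o.v - 1) * (o.w - 1))

/-- The shift of the merge. -/
def shift : ZMod n := (((o.v - 1) * (o.w - 1) : ℕ) : ZMod n) * o.z

/-- The array of lengths after the merge. -/
def apply (A : Lengths n) : Lengths n :=
  A - (Pi.single o.a o.t + Pi.single o.b o.s) + Pi.single o.z o.u

/-- The merge can be applied to the array of lengths `A`. -/
structure Valid (A : Lengths n) : Prop where
  z_ne : o.z ≠ 0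
  one_le_v : 1 ≤ o.v
  v_lt : o.v < n
  one_le_w : 1 ≤ o.w
  w_lt : o.w < n
  coprime : Nat.Coprime o.v o.w
  v_le : o.v ≤ o.t
  w_le : o.w ≤ o.s
  t_lt : o.t < n
  s_lt : o.s < n
  le : Pi.single o.a o.t + Pi.single o.b o.s ≤ A

end Merge

theorem merge_length_eq {v w t s : ℕ} (hv : 1 ≤ v) (hw : 1 ≤ w) (ht : v ≤ t) (hs : w ≤ s) :
    t * w + s * v - 2 * ((v - 1) * (w - 1)) + 2 * ((v - 1) * (w - 1)) = t * w + s * v := by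
  apply Nat.sub_add_cancel
  have h1 : (v - 1) * (w - 1) ≤ t * w := Nat.mul_le_mul (by omega) (by omega)
  have h2 : (w - 1) * (v - 1) ≤ s * v := Nat.mul_le_mul (by omega) (by omega)
  rw [Nat.mul_comm] at h2
  omega

/-- A merge of two different progressions gains length, in proportion to what it replaces. -/
theorem merge_gain {v w t s u : ℕ} (hv : 1 ≤ v) (hw : 1 ≤ w) (hne : ¬(v = 1 ∧ w = 1))
    (ht : v ≤ t) (hs : w ≤ s) (hu : u + 2 * ((v - 1) * (w - 1)) = t * w + s * v) :
    t + s + 1 ≤ u ∧ v + 2 * (t + s) ≤ 2 * u ∧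
      (if w = 1 then 0 else t) + (if v = 1 then 0 else s) + 2 * (t + s) ≤ 2 * u := by
  obtain ⟨v, rfl⟩ := Nat.exists_eq_add_of_le' hv
  obtain ⟨w, rfl⟩ := Nat.exists_eq_add_of_le' hw
  obtain ⟨t, rfl⟩ := Nat.exists_eq_add_of_le' ht
  obtain ⟨s, rfl⟩ := Nat.exists_eq_add_of_le' hs
  simp only [Nat.add_sub_cancel] at hu
  -- In terms of the excesses `v - 1`, `w - 1`, `t - v`, `s - w` the quadratic term `2 * (v - 1) *
  -- (w - 1)` cancels, leaving only nonnegative terms.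
  have hu' : u = t * w + s * v + 2 * v + 2 * w + t + s + 2 := by nlinarith
  rcases Nat.eq_zero_or_pos v with rfl | hv
  · have hw : 1 ≤ w := by omega
    have : t ≤ t * w := Nat.le_mul_of_pos_right _ hw
    refine ⟨by omega, by omega, ?_⟩
    split_ifs <;> omega
  · rcases Nat.eq_zero_or_pos w with rfl | hw
    · have : s ≤ s * v := Nat.le_mul_of_pos_right _ hv
      refine ⟨by omega, by omega, ?_⟩
      split_ifs <;> omega
    · have : t ≤ t * w := Nat.le_mul_of_pos_right _ hw
      have : s ≤ s * v := Nat.le_mul_of_pos_right _ hv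
      refine ⟨by omega, by omega, ?_⟩
      split_ifs <;> omega

/-- The quotient is rounded up. This keeps the second multiplier at most `s` for the first candidate
and so for all later ones. -/
theorem le_split {v w s N : ℕ} (hw : 1 ≤ w) :
    N ≤ (N - s * v + (w - 1)) / w * w + s * v := by
  have := Nat.lt_div_mul_add (a := N - s * v + (w - 1)) (b := w) (by omega)
  omega

/-- Every number in the middle range is `q * w + r * v` with `q ≤ t` and `r ≤ s`; the value of `q`
is found among `v` consecutive candidates. -/
theorem exists_split {v w t s N : ℕ} (hv : 1 ≤ v) (hw : 1 ≤ w) (hvw : Nat.Coprime v w)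
    (ht : v ≤ t) (hs : w ≤ s) (hN : (v - 1) * (w - 1) ≤ N)
    (hN' : N + (v - 1) * (w - 1) ≤ t * w + s * v) :
    ∃ j r, j < v ∧ (N - s * v + (w - 1)) / w + j ≤ t ∧
      ((N - s * v + (w - 1)) / w + j) * w + r * v = N := by
  set p := (N - s * v + (w - 1)) / w with hp
  obtain ⟨j, hj, hjN⟩ : ∃ j < v, ((v : ℤ) ∣ N - (p + j : ℤ) * w) := by
    have hv0 : v ≠ 0 := by omega
    have hu := ZMod.coe_mul_inv_eq_one (n := v) w hvw.symm
    have : NeZero v := ⟨hv0⟩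
    -- `j` is the least solution of `(p + j) * w = N` modulo `v`; `w` is invertible there by
    -- coprimality.
    refine ⟨((N : ZMod v) * (w : ZMod v)⁻¹ - p).val, ZMod.val_lt _, ?_⟩
    rw [← ZMod.intCast_zmod_eq_zero_iff_dvd]
    push_cast
    rw [ZMod.natCast_zmod_val]
    linear_combination (-(N : ZMod v)) * hu
  have hpw : p * w ≤ N - s * v + (w - 1) := Nat.div_mul_le_self _ _
  have hpw' : N ≤ p * w + s * v := le_split hw
  obtain ⟨r, hr⟩ := hjN
  obtain ⟨v, rfl⟩ := Nat.exists_eq_add_of_le' hv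
  obtain ⟨w, rfl⟩ := Nat.exists_eq_add_of_le' hw
  simp only [Nat.add_sub_cancel] at *
  have hlow : (N : ℤ) - s * (v + 1) ≤ p * (w + 1) := by
    zify at hpw'; linarith
  have hjv : (j : ℤ) ≤ v := by omega
  -- If `p = 0`, then `q = j < v ≤ t`, and a negative `r` would give `N < (v - 1) * (w - 1)`. If `p
  -- > 0`, the rounding in `p` gives `r > s - w`, and then `q > t` would push `N` above its upper
  -- bound.
  have hr0 : 0 ≤ r ∧ (p + j : ℤ) ≤ t := by
    by_cases hc : N ≤ s * (v + 1)
    · have hp0 : p = 0 := by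
        rw [hp, Nat.sub_eq_zero_of_le hc]; exact Nat.div_eq_of_lt (by omega)
      rw [hp0] at hr ⊢
      refine ⟨?_, by push_cast; omega⟩
      push_cast at hr
      by_contra hneg
      zify at hN
      nlinarith
    · have h1 : (p : ℤ) * (w + 1) ≤ N - s * (v + 1) + w := by
        have : p * (w + 1) + s * (v + 1) ≤ N + w := by omega
        zify at this; linarith
      push_cast at hr
      zify at hN' hs
      have hrs : (s : ℤ) - w ≤ r := by
        by_contra hneg
        have : r + 1 ≤ s - w := by omega
        nlinarith
      refine ⟨by linarith, ?_⟩
      by_contra hneg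
      have : (t : ℤ) + 1 ≤ p + j := by omega
      nlinarith
  obtain ⟨r, rfl⟩ := Int.eq_ofNat_of_zero_le hr0.1
  refine ⟨j, r, hj, by exact_mod_cast hr0.2, ?_⟩
  push_cast at hr
  zify
  linarith

section
variable {n : ℕ} [NeZero n]

theorem sum_update_add (m : ZMod n → ℕ) (a : ZMod n) (q : ℕ) :
    ∑ i, ((Function.update m a (m a + q) i : ℕ) : ZMod n) * i
      = ∑ i, (m i : ZMod n) * i + q * a := by
  have : ∀ i, ((Function.update m a (m a + q) i : ℕ) : ZMod n) * i
      = (m i : ZMod n) * i + if i = a then (q : ZMod n) * a else 0 := by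
    intro i
    by_cases h : i = a
    · subst h; simp [add_mul]
    · simp [h]
  simp [this, Finset.sum_add_distrib]

/-- A construction after a merge gives a construction before it. -/
theorem IsConstruction.undo {A : Lengths n} {o : Merge n} (ho : o.Valid A) {m : ZMod n → ℕ}
    {x : ZMod n} (hm : IsConstruction (o.apply A) m x) {q r : ℕ} (hq : q ≤ o.t) (hr : r ≤ o.s)
    (hqr : q * o.w + r * o.v = min (m o.z) o.u + (o.v - 1) * (o.w - 1)) {m₁ m₂ : ZMod n → ℕ}
    (h₁ : m₁ = Function.update m o.z (m o.z - min (m o.z) o.u))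
    (h₂ : m₂ = Function.update m₁ o.a (m₁ o.a + q)) :
    IsConstruction A (Function.update m₂ o.b (m₂ o.b + r)) (x + o.shift) := by
  obtain ⟨hle, hsum⟩ := hm
  constructor
  · intro i
    have h := hle i
    have hA := ho.le i
    -- As much as possible of the multiplicity of `z` is attributed to the new progression. What
    -- remains fits into the length that `z` had outside the merge.
    have e1 : m₁ i ≤ A i - (Pi.single (M := fun _ => ℕ) o.a o.t i + Pi.single (M := fun _ => ℕ) o.b o.s i) := by
      rw [h₁]
      simp only [Merge.apply, Pi.add_apply, Pi.sub_apply] at h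
      by_cases hz : i = o.z
      · subst hz; simp at h ⊢; omega
      · simpa [hz] using h
    have e2 : m₂ i ≤ m₁ i + Pi.single (M := fun _ => ℕ) o.a o.t i := by
      rw [h₂]
      by_cases hz : i = o.a
      · subst hz; simpa using hq
      · simp [hz]
    have e3 : Function.update m₂ o.b (m₂ o.b + r) i ≤ m₂ i + Pi.single (M := fun _ => ℕ) o.b o.s i := by
      by_cases hz : i = o.b
      · subst hz; simpa using hr
      · simp [hz]
    simp only [Pi.add_apply] at hA
    omega
  · rw [sum_update_add, h₂, sum_update_add]
    have hm : m = Function.update m₁ o.z (m₁ o.z + min (m o.z) o.u) := by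
      rw [h₁]; simp
    have hs : ∑ i, (m i : ZMod n) * i
        = ∑ i, (m₁ i : ZMod n) * i + (min (m o.z) o.u : ℕ) * o.z := by
      conv_lhs => rw [hm]
      exact sum_update_add _ _ _
    have hc := congrArg (Nat.cast : ℕ → ZMod n) hqr
    rw [← hsum, hs]
    simp only [Merge.shift, Merge.a, Merge.b]
    simp only [Nat.cast_add, Nat.cast_mul] at hc ⊢
    linear_combination o.z * hc

end

/-! ### Sequences of merges and the state of the growth algorithm. -/

/-- `Derives A l A' g`: the merges of the list `l` (the last one first) turn `A` into `A'`, with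
total shift `g`. -/
inductive Derives {n : ℕ} (A : Lengths n) : List (Merge n) → Lengths n → ZMod n → Prop
  | nil : Derives A [] A 0
  | cons {o : Merge n} {l : List (Merge n)} {A' : Lengths n} {g : ZMod n}
      (h : Derives A l A' g) (ho : o.Valid A') : Derives A (o :: l) (o.apply A') (g + o.shift)

section
variable {n : ℕ} [Fact n.Prime]

theorem natCast_ne_zero {i : ℕ} (h : 1 ≤ i) (h' : i < n) : (i : ZMod n) ≠ 0 := by
  rw [Ne, ZMod.natCast_eq_zero_iff]
  exact Nat.not_dvd_of_pos_of_lt h h'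

theorem natCast_inj {i j : ℕ} (hi : i < n) (hj : j < n) (h : (i : ZMod n) = j) : i = j := by
  have := congrArg ZMod.val h
  rwa [ZMod.val_cast_of_lt hi, ZMod.val_cast_of_lt hj] at this

theorem Derives.reach {A A' : Lengths n} {l : List (Merge n)} {g : ZMod n}
    (h : Derives A l A' g) : Reach A A' g := by
  induction h with
  | nil => exact .refl
  | @cons o l A' g h ho ih =>
    exact ih.step (.op2 o.a o.b o.z o.v o.w o.t o.s o.u
      (mul_ne_zero (natCast_ne_zero ho.one_le_w ho.w_lt) ho.z_ne)
      (mul_ne_zero (natCast_ne_zero ho.one_le_v ho.v_lt) ho.z_ne)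
      ⟨ho.one_le_v, ho.v_lt⟩ ⟨ho.one_le_w, ho.w_lt⟩ ho.coprime rfl rfl ho.v_le ho.w_le
      (merge_length_eq ho.one_le_v ho.one_le_w ho.v_le ho.w_le) ho.le)

/-- The state of the growth algorithm. The multiples `i * a` with `1 ≤ i ≤ f a` are entered in the
table `own` of owners. -/
structure State (n : ℕ) where
  L : Lengths n
  f : ZMod n → ℕ
  own : ZMod n → ZMod n
  cur : ZMod n
  p : ℕ
  g : ZMod n
  log : List (Merge n)

/-- The state at the beginning. -/
def State.init (n : ℕ) : State n := ⟨0, 0, 0, 0, 0, 0, []⟩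

/-- The next multiplier of the current difference. -/
def State.v (S : State n) : ℕ := S.f S.cur + 1
/-- The next multiple of the current difference. -/
def State.y (S : State n) : ZMod n := S.v * S.cur
/-- The owner of the next multiple. -/
def State.b (S : State n) : ZMod n := S.own S.y
/-- The multiplier of the owner. -/
def State.w (S : State n) : ℕ := (S.y * (S.b)⁻¹).val
/-- The merge on a collision. -/
def State.merge (S : State n) : Merge n :=
  ⟨S.cur * (S.w : ZMod n)⁻¹, S.v, S.w, S.L S.cur, S.L S.b⟩

/-- The next multiple is entered in the table. -/
def State.insert (S : State n) : State n :=
  { S with own := Function.update S.own S.y S.cur, f := Function.update S.f S.cur S.v }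

/-- The next progression of the input is taken up. -/
def State.load (S : State n) (A : Lengths n) : State n :=
  { S with
    p := S.p + 1
    cur := (S.p + 1 : ℕ)
    L := Function.update S.L (S.p + 1 : ℕ) (S.L (S.p + 1 : ℕ) + A (S.p + 1 : ℕ)) }

/-- The lengths after zeroing the two merged progressions. -/
def State.zeroed (S : State n) : Lengths n :=
  Function.update (Function.update S.L S.cur 0) S.b 0

/-- The counts after the current progression is merged. -/
def State.cutf (S : State n) : ZMod n → ℕ :=
  Function.update S.f S.cur (S.f S.cur * if S.w = 1 then 1 else 0)

/-- The current progression and the owner of its next multiple are merged. -/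
def State.collide (S : State n) : State n where
  L := Function.update S.zeroed S.merge.z (S.zeroed S.merge.z + S.merge.u)
  f := Function.update S.cutf S.b (S.cutf S.b * if S.v = 1 then 1 else 0)
  own := S.own
  cur := S.merge.z
  p := S.p
  g := S.g + S.merge.shift
  log := S.merge :: S.log

/-- The cost of undoing the merges of a list. -/
def undoCost (l : List (Merge n)) : ℕ := (l.map fun o => o.v).sum

/-- The invariant of the growth algorithm. -/
structure State.Inv (A : Lengths n) (S : State n) : Prop where
  own_eq : ∀ a i, 1 ≤ i → i ≤ S.f a → S.own (i * a) = a
  f_le : ∀ a, S.f a ≤ S.L a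
  f_eq : ∀ a, a ≠ S.cur → S.f a = S.L a
  L_zero : S.L 0 = 0
  f_lt : ∀ a, S.f a < n
  p_lt : S.p < n
  derives : ∃ A', Derives A S.log A' S.g ∧
    ∀ i, S.L i + (if S.p < i.val then A i else 0) ≤ A' i
  sum_ge : ∑ i, (if S.p < i.val then 0 else if i = 0 then 0 else A i) ≤ ∑ i, S.L i
  cost_le : undoCost S.log ≤ 2 * ∑ i, S.L i
  cost_le' : undoCost S.log ≤ 5 * n

theorem State.init_inv (A : Lengths n) : (State.init n).Inv A where
  own_eq a i hi h := by simp [State.init] at h; omega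
  f_le a := by simp [State.init]
  f_eq a _ := by simp [State.init]
  L_zero := by simp [State.init]
  f_lt a := (Fact.out : n.Prime).pos
  p_lt := (Fact.out : n.Prime).pos
  derives := ⟨A, .nil, fun i => by simp [State.init]; split_ifs <;> simp⟩
  sum_ge := by
    apply le_of_eq_of_le _ (Nat.zero_le _)
    apply Finset.sum_eq_zero
    intro i _
    by_cases h : i = 0
    · simp [h]
    · have : 0 < i.val := Nat.pos_of_ne_zero (by simpa using h)
      simp [State.init, this]
  cost_le := by simp [State.init, undoCost]
  cost_le' := by simp [State.init, undoCost]

/-! ### Preservation of the invariant and growth of the progress measure. -/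

variable {A : Lengths n} {S : State n}

theorem State.Inv.f_zero (h : S.Inv A) : S.f 0 = 0 := by
  have := h.f_le 0; rw [h.L_zero] at this; omega

/-- The entries of the table are different nonzero elements. -/
theorem State.Inv.sum_f_lt (h : S.Inv A) : ∑ a, S.f a < n := by
  have hc : (Finset.univ.sigma fun a : ZMod n => Finset.Icc 1 (S.f a)).card
      ≤ (Finset.univ.erase (0 : ZMod n)).card := by
    apply Finset.card_le_card_of_injOn (fun x => (x.2 : ZMod n) * x.1)
    · rintro ⟨a, i⟩ hi
      simp only [Finset.coe_sigma, Set.mem_sigma_iff, Finset.coe_Icc, Set.mem_Icc] at hi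
      simp only [Finset.coe_erase, Finset.coe_univ, Set.mem_sdiff, Set.mem_univ, true_and,
        Set.mem_singleton_iff]
      apply mul_ne_zero (natCast_ne_zero hi.2.1 (hi.2.2.trans_lt (h.f_lt a)))
      rintro rfl
      have := h.f_zero
      omega
    · rintro ⟨a, i⟩ hi ⟨b, j⟩ hj hij
      simp only [Finset.coe_sigma, Set.mem_sigma_iff, Finset.coe_Icc, Set.mem_Icc] at hi hj
      simp only at hij
      have hab : a = b := by
        rw [← h.own_eq a i hi.2.1 hi.2.2, hij, h.own_eq b j hj.2.1 hj.2.2]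
      subst hab
      have ha : a ≠ 0 := by
        rintro rfl
        have := h.f_zero
        omega
      have := natCast_inj (hi.2.2.trans_lt (h.f_lt a)) (hj.2.2.trans_lt (h.f_lt a))
        (mul_right_cancel₀ ha hij)
      rw [this]
  rw [Finset.card_sigma, Finset.card_erase_of_mem (Finset.mem_univ _), Finset.card_univ,
    ZMod.card] at hc
  simp only [Nat.card_Icc, Nat.add_sub_cancel] at hc
  have := (Fact.out : n.Prime).pos
  omega

theorem State.Inv.sum_L (h : S.Inv A) : ∑ a, S.L a + S.f S.cur = ∑ a, S.f a + S.L S.cur := by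
  have e1 : S.L S.cur + ∑ a ∈ Finset.univ.erase S.cur, S.L a = ∑ a, S.L a :=
    Finset.add_sum_erase _ S.L (Finset.mem_univ S.cur)
  have e2 : S.f S.cur + ∑ a ∈ Finset.univ.erase S.cur, S.f a = ∑ a, S.f a :=
    Finset.add_sum_erase _ S.f (Finset.mem_univ S.cur)
  have e3 : ∑ a ∈ Finset.univ.erase S.cur, S.f a = ∑ a ∈ Finset.univ.erase S.cur, S.L a :=
    Finset.sum_congr rfl fun a ha => h.f_eq a (Finset.ne_of_mem_erase ha)
  omega

/-- The measure of progress. -/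
def State.progress (S : State n) : ℕ := ∑ a, S.f a + 3 * ∑ a, S.L a + S.p

/-- Only the current progression can be partly unentered, so the sum of the lengths is below `n +
n`. The total is thus at most `n + 3 * (2 * n) + n`. -/
theorem State.Inv.progress_le (h : S.Inv A) (hL : S.L S.cur < n) : S.progress ≤ 8 * n := by
  have h1 := h.sum_f_lt
  have h2 := h.sum_L
  have h3 := h.p_lt
  unfold State.progress
  omega

/-- Owners are never erased when a progression disappears, so a cell may be stale. An entry `i * a`
at the cell `y` that is still live would have `b = a` and `w = i ≤ f a`, and the collision test
would have succeeded; overwriting is therefore harmless. -/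
theorem State.Inv.insert (h : S.Inv A) (hL : S.L S.cur < n) (hf : S.f S.cur < S.L S.cur)
    (hb : ¬ S.w - 1 < S.f S.b) : S.insert.Inv A ∧ S.insert.progress = S.progress + 1 := by
  have hcur : S.cur ≠ 0 := by
    intro h0; rw [h0, h.L_zero] at hf; omega
  constructor
  · constructor
    · intro a i hi hia
      simp only [State.insert] at hia ⊢
      by_cases hy : (i : ZMod n) * a = S.y
      · by_cases ha : a = S.cur
        · rw [hy, ha]; simp
        · exfalso
          simp only [Function.update_of_ne ha] at hia
          have hown : S.b = a := by rw [State.b, ← hy, h.own_eq a i hi hia]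
          have ha0 : a ≠ 0 := by
            rintro rfl
            have := h.f_zero
            omega
          have hw : S.w = i := by
            rw [State.w, hown, ← hy, mul_inv_cancel_right₀ ha0,
              ZMod.val_cast_of_lt (hia.trans_lt (h.f_lt a))]
          rw [hw, hown] at hb
          omega
      · rw [Function.update_of_ne hy]
        by_cases ha : a = S.cur
        · subst ha
          simp only [Function.update_self] at hia
          apply h.own_eq _ i hi
          have : i ≠ S.v := fun e => hy (by rw [e]; rfl)
          unfold State.v at *
          omega
        · simp only [Function.update_of_ne ha] at hia
          exact h.own_eq a i hi hia
    · intro a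
      simp only [State.insert]
      by_cases ha : a = S.cur
      · subst ha; simpa [State.v] using hf
      · simpa [ha] using h.f_le a
    · intro a ha
      simp only [State.insert] at ha ⊢
      simpa [ha] using h.f_eq a ha
    · exact h.L_zero
    · intro a
      simp only [State.insert]
      by_cases ha : a = S.cur
      · subst ha; simp [State.v]; omega
      · simpa [ha] using h.f_lt a
    · exact h.p_lt
    · exact h.derives
    · exact h.sum_ge
    · exact h.cost_le
    · exact h.cost_le'
  · simp only [State.progress, State.insert]
    have e1 : S.f S.cur + ∑ a ∈ Finset.univ.erase S.cur, S.f a = ∑ a, S.f a :=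
      Finset.add_sum_erase _ S.f (Finset.mem_univ S.cur)
    have e2 := Finset.add_sum_erase _ (Function.update S.f S.cur S.v) (Finset.mem_univ S.cur)
    have e3 : ∑ a ∈ Finset.univ.erase S.cur, Function.update S.f S.cur S.v a
        = ∑ a ∈ Finset.univ.erase S.cur, S.f a :=
      Finset.sum_congr rfl fun a ha => Function.update_of_ne (Finset.ne_of_mem_erase ha) _ _
    rw [e3, Function.update_self] at e2
    rw [← e1, ← e2, State.v]
    omega

/-- The input is not exhausted before a collision. -/
theorem State.Inv.p_succ_lt (h : S.Inv A) (hA : n ≤ ∑ i, if i = 0 then 0 else A i)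
    (hf : ¬ S.f S.cur < S.L S.cur) : S.p + 1 < n := by
  by_contra hp
  have h1 := h.sum_f_lt
  have h2 := h.sum_L
  have h3 := h.f_le S.cur
  have h4 := h.sum_ge
  rw [Finset.sum_congr rfl fun i _ => if_neg (by have := ZMod.val_lt i; omega)] at h4
  omega

/-- A load happens only when every progression is fully entered, so the new current difference may
be any one. If an earlier merge already produced it, the lengths add up and its old entries stay
valid. -/
theorem State.Inv.load (h : S.Inv A) (hA : n ≤ ∑ i, if i = 0 then 0 else A i)
    (hf : ¬ S.f S.cur < S.L S.cur) :
    (S.load A).Inv A ∧ S.progress + 1 ≤ (S.load A).progress := by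
  have hp := h.p_succ_lt hA hf
  have hc0 : ((S.p + 1 : ℕ) : ZMod n) ≠ 0 := natCast_ne_zero (by omega) hp
  have hval : ((S.p + 1 : ℕ) : ZMod n).val = S.p + 1 := ZMod.val_cast_of_lt hp
  have hall : ∀ a, S.f a = S.L a := by
    intro a
    by_cases ha : a = S.cur
    · subst ha; have := h.f_le S.cur; omega
    · exact h.f_eq a ha
  have hpl : (S.load A).p = S.p + 1 := rfl
  have hL : ∀ i, (S.load A).L i = S.L i + if i.val = S.p + 1 then A i else 0 := by
    intro i
    simp only [State.load]
    by_cases hi : i = ((S.p + 1 : ℕ) : ZMod n)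
    · rw [hi, hval]; simp
    · have : i.val ≠ S.p + 1 := fun e => hi (by rw [← e, ZMod.natCast_zmod_val])
      simp only [Function.update_of_ne hi, if_neg this, add_zero]
  have hsum : ∑ i, S.L i ≤ ∑ i, (S.load A).L i :=
    Finset.sum_le_sum fun i _ => by rw [hL]; omega
  constructor
  · constructor
    · exact h.own_eq
    · intro a
      rw [hL]
      exact (h.f_le a).trans (Nat.le_add_right _ _)
    · intro a ha
      simp only [State.load] at ha ⊢
      rw [Function.update_of_ne ha]
      exact hall a
    · rw [hL, h.L_zero]; simp
    · exact h.f_lt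
    · exact hp
    · obtain ⟨A', hd, hle⟩ := h.derives
      refine ⟨A', hd, fun i => ?_⟩
      have := hle i
      rw [hL, hpl]
      split_ifs at this ⊢ <;> omega
    · calc ∑ i, (if (S.load A).p < i.val then 0 else if i = 0 then 0 else A i)
          ≤ ∑ i, ((if S.p < i.val then 0 else if i = 0 then 0 else A i) +
              if i.val = S.p + 1 then A i else 0) := by
            apply Finset.sum_le_sum
            intro i _
            rw [hpl]
            split_ifs <;> omega
        _ ≤ ∑ i, (S.load A).L i := by
            simp only [hL]
            rw [Finset.sum_add_distrib, Finset.sum_add_distrib]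
            exact Nat.add_le_add_right h.sum_ge _
    · exact h.cost_le.trans (by omega)
    · exact h.cost_le'
  · unfold State.progress
    have : ∑ a, (S.load A).f a = ∑ a, S.f a := rfl
    have : (S.load A).p = S.p + 1 := rfl
    omega

/-! ### Collisions. -/

/-- The facts about a collision. -/
structure State.Collision (S : State n) : Prop where
  cur_ne : S.cur ≠ 0
  b_ne : S.b ≠ 0
  ne : S.cur ≠ S.b
  v_lt : S.v < n
  one_le_w : 1 ≤ S.w
  w_lt : S.w < n
  z_ne : S.merge.z ≠ 0
  a_eq : S.merge.a = S.cur
  b_eq : S.merge.b = S.b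
  coprime : Nat.Coprime S.v S.w
  v_le : S.v ≤ S.L S.cur
  w_le : S.w ≤ S.L S.b
  w_one : S.w = 1 ↔ S.cur = S.merge.z
  v_one : S.v = 1 ↔ S.b = S.merge.z

theorem State.Inv.collision (h : S.Inv A) (hL : S.L S.cur < n) (hf : S.f S.cur < S.L S.cur)
    (hb : S.w - 1 < S.f S.b) : S.Collision := by
  have hcur : S.cur ≠ 0 := by
    intro h0; rw [h0, h.L_zero] at hf; omega
  have hb0 : S.b ≠ 0 := by
    intro h0; rw [h0, h.f_zero] at hb; omega
  have hvn : S.v < n := by unfold State.v; omega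
  have hv1 : 1 ≤ S.v := by unfold State.v; omega
  have hvc : (S.v : ZMod n) ≠ 0 := natCast_ne_zero hv1 hvn
  have hw : (S.w : ZMod n) * S.b = S.v * S.cur := by
    rw [State.w, ZMod.natCast_zmod_val, inv_mul_cancel_right₀ hb0]; rfl
  have hwc : (S.w : ZMod n) ≠ 0 := by
    intro h0
    rw [h0, zero_mul] at hw
    exact mul_ne_zero hvc hcur hw.symm
  have hw1 : 1 ≤ S.w := Nat.one_le_iff_ne_zero.mpr fun e => hwc (by rw [e]; simp)
  have hwn : S.w < n := ZMod.val_lt _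
  have hwf : S.w ≤ S.f S.b := by omega
  have hne : S.cur ≠ S.b := by
    intro e
    rw [← e] at hw hwf
    have := natCast_inj hwn hvn (mul_right_cancel₀ hcur hw)
    unfold State.v at this
    omega
  have hz : S.merge.z ≠ 0 := mul_ne_zero hcur (inv_ne_zero hwc)
  have ha : S.merge.a = S.cur := by
    change (S.w : ZMod n) * (S.cur * (S.w : ZMod n)⁻¹) = S.cur
    field_simp
  have hbe : S.merge.b = S.b := by
    change (S.v : ZMod n) * (S.cur * (S.w : ZMod n)⁻¹) = S.b
    field_simp
    linear_combination -hw
  refine ⟨hcur, hb0, hne, hvn, hw1, hwn, hz, ha, hbe, ?_, ?_, ?_, ?_, ?_⟩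
  -- Dividing `v * cur = w * b` by the gcd gives `v' * cur = w' * b` with `v' < v` and `w' ≤ w`.
  -- Both multiples are already entered, so one cell would have two owners.
  · by_contra hg
    have hd1 : 1 < Nat.gcd S.v S.w := by
      have := Nat.gcd_pos_of_pos_left S.w hv1
      unfold Nat.Coprime at hg
      omega
    obtain ⟨v', hv'⟩ := Nat.gcd_dvd_left S.v S.w
    obtain ⟨w', hw'⟩ := Nat.gcd_dvd_right S.v S.w
    set d := Nat.gcd S.v S.w
    have hv'1 : 1 ≤ v' := Nat.one_le_iff_ne_zero.mpr fun e => by rw [e] at hv'; omega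
    have hw'1 : 1 ≤ w' := Nat.one_le_iff_ne_zero.mpr fun e => by rw [e] at hw'; omega
    have hlt : v' < S.v := by rw [hv']; nlinarith
    have hlt' : w' ≤ S.w := by rw [hw']; nlinarith
    have hdn : d < n := (Nat.gcd_le_left S.w hv1).trans_lt hvn
    have heq : (w' : ZMod n) * S.b = v' * S.cur := by
      apply mul_left_cancel₀ (natCast_ne_zero hd1.le hdn)
      have e1 := congrArg (Nat.cast : ℕ → ZMod n) hv'
      have e2 := congrArg (Nat.cast : ℕ → ZMod n) hw'
      push_cast at e1 e2
      linear_combination hw - S.b * e2 + S.cur * e1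
    apply hne
    rw [← h.own_eq S.cur v' hv'1 (by unfold State.v at hlt; omega), ← heq,
      h.own_eq S.b w' hw'1 (hlt'.trans hwf)]
  · exact hf
  · exact hwf.trans (h.f_le _)
  · rw [← ha]
    change _ ↔ (S.w : ZMod n) * S.merge.z = _
    constructor
    · intro e; rw [e]; simp
    · intro e
      have : (S.w : ZMod n) = (1 : ℕ) := by
        rw [Nat.cast_one]; exact mul_right_cancel₀ hz (by rw [e, one_mul])
      exact natCast_inj hwn (Fact.out : n.Prime).one_lt this
  · rw [← hbe]
    change _ ↔ (S.v : ZMod n) * S.merge.z = _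
    constructor
    · intro e; rw [e]; simp
    · intro e
      have : (S.v : ZMod n) = (1 : ℕ) := by
        rw [Nat.cast_one]; exact mul_right_cancel₀ hz (by rw [e, one_mul])
      exact natCast_inj hvn (Fact.out : n.Prime).one_lt this

theorem State.Collision.gain (c : S.Collision) :
    S.L S.cur + S.L S.b + 1 ≤ S.merge.u ∧ S.v + 2 * (S.L S.cur + S.L S.b) ≤ 2 * S.merge.u ∧
      (if S.w = 1 then 0 else S.L S.cur) + (if S.v = 1 then 0 else S.L S.b)
        + 2 * (S.L S.cur + S.L S.b) ≤ 2 * S.merge.u := by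
  have hv : 1 ≤ S.v := by unfold State.v; omega
  apply merge_gain hv c.one_le_w _ c.v_le c.w_le
    (merge_length_eq hv c.one_le_w c.v_le c.w_le)
  rintro ⟨h1, h2⟩
  exact c.ne ((c.w_one.mp h2).trans (c.v_one.mp h1).symm)

/-- The additive form avoids truncated subtraction and covers the cases in which `z` coincides with
`cur` or `b`. -/
theorem State.Collision.L_add (c : S.Collision) (i : ZMod n) :
    S.collide.L i + (Pi.single (M := fun _ => ℕ) S.cur (S.L S.cur) i
      + Pi.single (M := fun _ => ℕ) S.b (S.L S.b) i)
      = S.L i + Pi.single (M := fun _ => ℕ) S.merge.z S.merge.u i := by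
  have hne := c.ne
  have key : S.zeroed i + (Pi.single (M := fun _ => ℕ) S.cur (S.L S.cur) i
      + Pi.single (M := fun _ => ℕ) S.b (S.L S.b) i) = S.L i := by
    simp only [State.zeroed, Function.update_apply, Pi.single_apply]
    by_cases h1 : i = S.b
    · have : i ≠ S.cur := fun e => hne (by rw [← e, h1])
      simp [h1, hne.symm]
    · by_cases h2 : i = S.cur <;> simp [h1, h2, hne]
  rw [← key]
  simp only [State.collide]
  by_cases hz : i = S.merge.z
  · subst hz; simp; omega
  · simp [hz]

theorem State.Collision.f_eq (c : S.Collision) (i : ZMod n) :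
    S.collide.f i = if (i = S.cur ∧ S.w ≠ 1) ∨ (i = S.b ∧ S.v ≠ 1) then 0 else S.f i := by
  have hne := c.ne
  have hne' := c.ne.symm
  simp only [State.collide, State.cutf, Function.update_apply]
  by_cases h1 : i = S.b
  · subst h1
    by_cases h3 : S.v = 1 <;> simp [hne', h3]
  · by_cases h2 : i = S.cur
    · subst h2
      by_cases h3 : S.w = 1 <;> simp [h1, h3]
    · simp [h1, h2]

/-- A merged progression loses its entries unless its difference is `z` itself, which happens for
`cur` when `w = 1` and for `b` when `v = 1`. The lost entries are paid for by two of the three units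
of weight on the length; the third makes the measure strictly larger. -/
theorem State.Inv.collide (h : S.Inv A) (hL : S.L S.cur < n) (hf : S.f S.cur < S.L S.cur)
    (hb : S.w - 1 < S.f S.b) :
    S.collide.Inv A ∧ S.progress + 1 ≤ S.collide.progress := by
  have c := h.collision hL hf hb
  have hv1 : 1 ≤ S.v := by unfold State.v; omega
  obtain ⟨g1, g2, g3⟩ := c.gain
  have hsumL : ∑ i, S.collide.L i + (S.L S.cur + S.L S.b) = ∑ i, S.L i + S.merge.u := by
    have := Finset.sum_congr (rfl : (Finset.univ : Finset (ZMod n)) = _) fun i _ => c.L_add i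
    simpa [Finset.sum_add_distrib] using this
  have hfle : ∀ i, S.collide.f i ≤ S.f i := by
    intro i; rw [c.f_eq]; split_ifs <;> omega
  have hsumf : ∑ i, S.f i ≤ ∑ i, S.collide.f i +
      ((if S.w = 1 then 0 else S.L S.cur) + (if S.v = 1 then 0 else S.L S.b)) := by
    have : ∀ i, S.f i ≤ S.collide.f i
        + ((if i = S.cur then (if S.w = 1 then 0 else S.L S.cur) else 0)
          + if i = S.b then (if S.v = 1 then 0 else S.L S.b) else 0) := by
      intro i
      rw [c.f_eq]
      have hfL := h.f_le i
      by_cases h1 : i = S.cur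
      · subst h1
        by_cases h3 : S.w = 1 <;> simp [h3, c.ne]; exact hfL
      · by_cases h2 : i = S.b
        · subst h2
          by_cases h3 : S.v = 1 <;> simp [h3, h1]; exact hfL
        · simp [h1, h2]
    refine (Finset.sum_le_sum fun i _ => this i).trans ?_
    simp [Finset.sum_add_distrib]
  have hcost : undoCost S.collide.log = S.v + undoCost S.log := by
    simp [State.collide, undoCost, State.merge]
  have hLb : S.L S.b < n := by rw [← h.f_eq S.b c.ne.symm]; exact h.f_lt _
  constructor
  · constructor
    · intro a i hi hia
      exact h.own_eq a i hi (hia.trans (hfle a))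
    · intro a
      have e1 := c.L_add a
      have e2 := h.f_le a
      rw [c.f_eq]
      split_ifs with hc
      · omega
      · push Not at hc
        simp only [Pi.single_apply] at e1
        by_cases h1 : a = S.cur
        · have hz := c.w_one.mp (hc.1 h1)
          have : a ≠ S.b := fun e => c.ne (by rw [← h1, e])
          simp only [if_pos h1, if_neg this, if_pos (h1.trans hz)] at e1
          omega
        · by_cases h2 : a = S.b
          · have hz := c.v_one.mp (hc.2 h2)
            simp only [if_pos h2, if_neg h1, if_pos (h2.trans hz)] at e1
            omega
          · simp only [if_neg h1, if_neg h2] at e1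
            omega
    · intro a ha
      have ha : a ≠ S.merge.z := ha
      have e1 := c.L_add a
      simp only [Pi.single_apply, if_neg ha] at e1
      rw [c.f_eq]
      by_cases h1 : a = S.cur
      · have hw : S.w ≠ 1 := fun e => ha (h1.trans (c.w_one.mp e))
        have : a ≠ S.b := fun e => c.ne (by rw [← h1, e])
        simp only [if_pos h1, if_neg this] at e1
        rw [h1] at e1
        rw [if_pos (Or.inl ⟨h1, hw⟩), h1]
        omega
      · by_cases h2 : a = S.b
        · have hv : S.v ≠ 1 := fun e => ha (h2.trans (c.v_one.mp e))
          simp only [if_pos h2, if_neg h1] at e1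
          rw [h2] at e1
          rw [if_pos (Or.inr ⟨h2, hv⟩), h2]
          omega
        · simp only [if_neg h1, if_neg h2] at e1
          have := h.f_eq a h1
          rw [if_neg (by tauto)]
          omega
    · have e1 := c.L_add 0
      simp only [Pi.single_apply, if_neg c.cur_ne.symm, if_neg c.b_ne.symm, if_neg c.z_ne.symm,
        h.L_zero] at e1
      omega
    · exact fun a => (hfle a).trans_lt (h.f_lt a)
    · exact h.p_lt
    · obtain ⟨A', hd, hle⟩ := h.derives
      refine ⟨_, hd.cons (o := S.merge) ⟨c.z_ne, hv1, c.v_lt, c.one_le_w, c.w_lt, c.coprime,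
        c.v_le, c.w_le, hL, hLb, ?_⟩, ?_⟩
      · intro i
        rw [c.a_eq, c.b_eq]
        have e1 := c.L_add i
        have e2 := hle i
        change Pi.single (M := fun _ => ℕ) S.cur (S.L S.cur) i
          + Pi.single (M := fun _ => ℕ) S.b (S.L S.b) i ≤ _
        have e3 : Pi.single (M := fun _ => ℕ) S.cur (S.L S.cur) i
            + Pi.single (M := fun _ => ℕ) S.b (S.L S.b) i ≤ S.L i := by
          simp only [Pi.single_apply]
          by_cases h1 : i = S.cur
          · subst h1; simp [c.ne]
          · by_cases h2 : i = S.b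
            · subst h2; simp [h1]
            · simp [h1, h2]
        omega
      · intro i
        have e1 := c.L_add i
        have e2 := hle i
        simp only [Merge.apply, c.a_eq, c.b_eq, Pi.add_apply, Pi.sub_apply]
        change _ ≤ A' i - (Pi.single (M := fun _ => ℕ) S.cur (S.L S.cur) i
          + Pi.single (M := fun _ => ℕ) S.b (S.L S.b) i) + _
        have : S.collide.p = S.p := rfl
        rw [this]
        omega
    · have : S.collide.p = S.p := rfl
      rw [this]
      exact h.sum_ge.trans (by omega)
    · have := h.cost_le
      omega
    -- Before the merge the lengths sum to less than `2 * n`, so the old cost is below `4 * n`; the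
    -- new merge adds `v < n`.
    · have := h.cost_le
      have := h.sum_L
      have := h.sum_f_lt
      have := c.v_lt
      omega
  · unfold State.progress
    have : S.collide.p = S.p := rfl
    omega

end
end APSum
-- Rules for halting, postconditions and running times of programs.
namespace WordRAM

namespace Expr

instance : Add Expr := ⟨.bin .add⟩
instance : Sub Expr := ⟨.bin .sub⟩
instance : Mul Expr := ⟨.bin .mul⟩
instance : Div Expr := ⟨.bin .div⟩
instance : Mod Expr := ⟨.bin .mod⟩
instance (c : ℕ) : OfNat Expr c := ⟨.const c⟩

variable (B : ℕ) (σ : Store) (e f : Expr)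

@[simp] theorem eval_ofNat (c : ℕ) : (ofNat(c) : Expr).eval σ = OfNat.ofNat c := rfl
@[simp] theorem eval_reg (x : ℕ) : (Expr.reg x).eval σ = σ.reg x := rfl
@[simp] theorem eval_cell (a : ℕ) : (Expr.cell a e).eval σ = σ.arr a (e.eval σ) := rfl
@[simp] theorem eval_add : (e + f).eval σ = e.eval σ + f.eval σ := rfl
@[simp] theorem eval_sub : (e - f).eval σ = e.eval σ - f.eval σ := rfl
@[simp] theorem eval_mul : (e * f).eval σ = e.eval σ * f.eval σ := rfl
@[simp] theorem eval_div : (e / f).eval σ = e.eval σ / f.eval σ := rfl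
@[simp] theorem eval_mod : (e % f).eval σ = e.eval σ % f.eval σ := rfl
@[simp] theorem eval_lt : (Expr.bin .lt e f).eval σ = if e.eval σ < f.eval σ then 1 else 0 := rfl
@[simp] theorem eval_eq : (Expr.bin .eq e f).eval σ = if e.eval σ = f.eval σ then 1 else 0 := rfl

@[simp] theorem fits_ofNat (c : ℕ) : (ofNat(c) : Expr).Fits B σ ↔ OfNat.ofNat c < B := Iff.rfl
@[simp] theorem fits_reg (x : ℕ) : (Expr.reg x).Fits B σ ↔ σ.reg x < B := Iff.rfl
@[simp] theorem fits_cell (a : ℕ) :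
    (Expr.cell a e).Fits B σ ↔ e.Fits B σ ∧ σ.arr a (e.eval σ) < B := Iff.rfl
@[simp] theorem fits_add :
    (e + f).Fits B σ ↔ e.Fits B σ ∧ f.Fits B σ ∧ e.eval σ + f.eval σ < B := Iff.rfl
@[simp] theorem fits_mul :
    (e * f).Fits B σ ↔ e.Fits B σ ∧ f.Fits B σ ∧ e.eval σ * f.eval σ < B := Iff.rfl

variable {B σ e f}

theorem Fits.eval_lt (h : e.Fits B σ) : e.eval σ < B := by
  cases e <;> first | exact h | exact h.2 | exact h.2.2

@[simp] theorem fits_sub : (e - f).Fits B σ ↔ e.Fits B σ ∧ f.Fits B σ :=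
  ⟨fun h => ⟨h.1, h.2.1⟩, fun h => ⟨h.1, h.2, (Nat.sub_le _ _).trans_lt h.1.eval_lt⟩⟩

@[simp] theorem fits_div : (e / f).Fits B σ ↔ e.Fits B σ ∧ f.Fits B σ :=
  ⟨fun h => ⟨h.1, h.2.1⟩, fun h => ⟨h.1, h.2, (Nat.div_le_self _ _).trans_lt h.1.eval_lt⟩⟩

@[simp] theorem fits_mod : (e % f).Fits B σ ↔ e.Fits B σ ∧ f.Fits B σ :=
  ⟨fun h => ⟨h.1, h.2.1⟩, fun h => ⟨h.1, h.2, (Nat.mod_le _ _).trans_lt h.1.eval_lt⟩⟩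

theorem ite_lt_of_one_lt {p : Prop} [Decidable p] (hB : 1 < B) : (if p then 1 else 0) < B := by
  split_ifs <;> omega

theorem fits_lt (hB : 1 < B) : (Expr.bin .lt e f).Fits B σ ↔ e.Fits B σ ∧ f.Fits B σ :=
  ⟨fun h => ⟨h.1, h.2.1⟩, fun h => ⟨h.1, h.2, ite_lt_of_one_lt hB⟩⟩

theorem fits_eq (hB : 1 < B) : (Expr.bin .eq e f).Fits B σ ↔ e.Fits B σ ∧ f.Fits B σ :=
  ⟨fun h => ⟨h.1, h.2.1⟩, fun h => ⟨h.1, h.2, ite_lt_of_one_lt hB⟩⟩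

end Expr

/-- A bound for the number of steps of a program without loops. -/
def Prog.steps : Prog → ℕ
  | .skip => 1
  | .set _ e => e.cost + 1
  | .store _ i e => i.cost + e.cost + 1
  | .seq p q => p.steps + q.steps
  | .ite e p q => e.cost + 1 + max p.steps q.steps
  | .loop _ _ => 0

/-- The program halts within `T` steps, with a memory that satisfies `Q`. -/
def Ends (B : ℕ) (p : Prog) (σ : Store) (T : ℕ) (Q : Store → Prop) : Prop :=
  ∃ τ t, Exec B p σ τ t ∧ t ≤ T ∧ Q τ

/-- The memory after register `x` is set to `v`. -/
def Store.setReg (σ : Store) (x v : ℕ) : Store := { σ with reg := Function.update σ.reg x v }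

/-- The memory after cell `i` of array `a` is set to `v`. -/
def Store.setCell (σ : Store) (a i v : ℕ) : Store :=
  { σ with arr := Function.update σ.arr a (Function.update (σ.arr a) i v) }

section
variable (σ : Store) (x y v a b i j : ℕ)

@[simp] theorem Store.reg_setReg : (σ.setReg x v).reg y = if y = x then v else σ.reg y := by
  simp [Store.setReg, Function.update_apply]

@[simp] theorem Store.arr_setReg : (σ.setReg x v).arr = σ.arr := rfl

@[simp] theorem Store.reg_setCell : (σ.setCell a i v).reg = σ.reg := rfl

@[simp] theorem Store.arr_setCell :
    (σ.setCell a i v).arr b = if b = a then Function.update (σ.arr a) i v else σ.arr b := by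
  simp [Store.setCell, Function.update_apply]

end

variable {B : ℕ} {p q : Prog} {σ : Store} {T T₁ T₂ : ℕ} {Q Q' : Store → Prop} {e : Expr}

theorem Ends.mono (h : Ends B p σ T₁ Q') (hT : T₁ ≤ T) (hQ : ∀ τ, Q' τ → Q τ) :
    Ends B p σ T Q :=
  let ⟨τ, t, h1, h2, h3⟩ := h
  ⟨τ, t, h1, h2.trans hT, hQ τ h3⟩

theorem Ends.seq (h : Ends B p σ T₁ fun τ => Ends B q τ T₂ Q) :
    Ends B (.seq p q) σ (T₁ + T₂) Q :=
  let ⟨_, _, h1, h2, υ, _, h3, h4, h5⟩ := h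
  ⟨υ, _, .seq h1 h3, Nat.add_le_add h2 h4, h5⟩

theorem Ends.set {x : ℕ} (v : ℕ) (he : e.Fits B σ) (hv : e.eval σ = v)
    (h : Q (σ.setReg x v)) : Ends B (.set x e) σ (Prog.set x e).steps Q := by
  subst hv
  exact ⟨_, _, .set σ x e he, le_rfl, h⟩

theorem Ends.store {a : ℕ} {d : Expr} (i v : ℕ) (hd : d.Fits B σ) (he : e.Fits B σ)
    (hi : d.eval σ = i) (hv : e.eval σ = v) (h : Q (σ.setCell a i v)) :
    Ends B (.store a d e) σ (Prog.store a d e).steps Q := by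
  subst hi hv
  exact ⟨_, _, .store σ a d e hd he, le_rfl, h⟩

theorem Ends.set_seq {x : ℕ} (v : ℕ) (he : e.Fits B σ) (hv : e.eval σ = v)
    (h : Ends B q (σ.setReg x v) q.steps Q) :
    Ends B (.seq (.set x e) q) σ (Prog.seq (.set x e) q).steps Q :=
  .seq (.set v he hv h)

theorem Ends.store_seq {a : ℕ} {d : Expr} (i v : ℕ) (hd : d.Fits B σ) (he : e.Fits B σ)
    (hi : d.eval σ = i) (hv : e.eval σ = v) (h : Ends B q (σ.setCell a i v) q.steps Q) :
    Ends B (.seq (.store a d e) q) σ (Prog.seq (.store a d e) q).steps Q :=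
  .seq (.store i v hd he hi hv h)

theorem Ends.ite (he : e.Fits B σ) (hp : e.eval σ ≠ 0 → Ends B p σ p.steps Q)
    (hq : e.eval σ = 0 → Ends B q σ q.steps Q) :
    Ends B (.ite e p q) σ (Prog.ite e p q).steps Q := by
  by_cases h : e.eval σ = 0
  · obtain ⟨τ, t, h1, h2, h3⟩ := hq h
    refine ⟨τ, _, .iteFalse he h h1, ?_, h3⟩
    simp only [Prog.steps]; omega
  · obtain ⟨τ, t, h1, h2, h3⟩ := hp h
    refine ⟨τ, _, .iteTrue he h h1, ?_, h3⟩
    simp only [Prog.steps]; omega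

theorem Ends.loop_done (he : e.Fits B σ) (h : e.eval σ = 0) (hQ : Q σ) :
    Ends B (.loop e p) σ (e.cost + 1) Q :=
  ⟨σ, _, .loopDone he h, le_rfl, hQ⟩

theorem Ends.loop_step (he : e.Fits B σ) (h : e.eval σ ≠ 0)
    (hp : Ends B p σ T₁ fun τ => Ends B (.loop e p) τ T₂ Q) :
    Ends B (.loop e p) σ (e.cost + 1 + T₁ + T₂) Q :=
  let ⟨_, _, h1, h2, υ, _, h3, h4, h5⟩ := hp
  ⟨υ, _, .loopStep he h h1 h3, by omega, h5⟩

/-- The rule for loops, with an invariant `I` about the memory and a ghost state, and a decreasing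
measure `μ` of the ghost state. -/
theorem Ends.loop {α : Type*} (I : α → Store → Prop) (μ : α → ℕ) (T : ℕ)
    (he : ∀ a σ, I a σ → e.Fits B σ)
    (hp : ∀ a σ, I a σ → e.eval σ ≠ 0 → Ends B p σ T fun τ => ∃ a', I a' τ ∧ μ a' < μ a)
    (a : α) (h : I a σ) :
    Ends B (.loop e p) σ (μ a * (T + e.cost + 1) + e.cost + 1)
      fun τ => ∃ a, I a τ ∧ e.eval τ = 0 := by
  induction hm : μ a using Nat.strong_induction_on generalizing a σ with
  | _ m ih =>
    by_cases hc : e.eval σ = 0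
    · exact ⟨σ, _, .loopDone (he a σ h) hc, by omega, a, h, hc⟩
    · obtain ⟨τ, t, h1, h2, a', h3, h4⟩ := hp a σ h hc
      obtain ⟨υ, t', h5, h6, h7⟩ := ih (μ a') (hm ▸ h4) a' h3 rfl
      refine ⟨υ, _, .loopStep (he a σ h) hc h1 h5, ?_, h7⟩
      have : (μ a' + 1) * (T + e.cost + 1) ≤ m * (T + e.cost + 1) :=
        Nat.mul_le_mul_right _ (by omega)
      rw [Nat.succ_mul] at this
      omega

end WordRAM
open WordRAM
namespace APSum

/-! ### The growth program and its correctness. -/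

/-- The next inverse modulo `n`. -/
def inverseStep : Prog :=
  .seq (.store 6 (.reg 5) ((.reg 0 - (.reg 0 / .reg 5 * .cell 6 (.reg 0 % .reg 5)) % .reg 0)
    % .reg 0)) <|
  .set 5 (.reg 5 + 1)

/-- The table of inverses modulo `n`, in array `6`. -/
def inverseProg : Prog :=
  .seq (.store 6 1 1) <|
  .seq (.set 5 2) <|
  .loop (.bin .lt (.reg 5) (.reg 0)) inverseStep

/-- A collision is merged and logged. -/
def collideProg : Prog :=
  .seq (.set 11 (.cell 1 (.reg 3))) <|
  .seq (.set 12 (.cell 1 (.reg 7))) <|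
  .seq (.set 9 ((.reg 3 * .cell 6 (.reg 8)) % .reg 0)) <|
  .seq (.set 10 (.reg 11 * .reg 8 + .reg 12 * .reg 5 - 2 * ((.reg 5 - 1) * (.reg 8 - 1)))) <|
  .seq (.store 1 (.reg 3) 0) <|
  .seq (.store 1 (.reg 7) 0) <|
  .seq (.store 1 (.reg 9) (.cell 1 (.reg 9) + .reg 10)) <|
  .seq (.store 4 (.reg 3) (.cell 4 (.reg 3) * .bin .eq (.reg 8) 1)) <|
  .seq (.store 4 (.reg 7) (.cell 4 (.reg 7) * .bin .eq (.reg 5) 1)) <|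
  .seq (.store 7 (.reg 4) (.reg 9)) <|
  .seq (.store 8 (.reg 4) (.reg 5)) <|
  .seq (.store 9 (.reg 4) (.reg 8)) <|
  .seq (.store 10 (.reg 4) (.reg 12)) <|
  .seq (.store 11 (.reg 4) (.reg 10)) <|
  .seq (.set 4 (.reg 4 + 1)) <|
  .seq (.set 1 ((.reg 1 + (.reg 5 - 1) * (.reg 8 - 1) * .reg 9) % .reg 0)) <|
  .set 3 (.reg 9)

/-- The next multiple is entered in the table. -/
def insertProg : Prog :=
  .seq (.store 5 (.reg 6) (.reg 3)) <|
  .store 4 (.reg 3) (.reg 5)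

/-- The next progression of the input is taken up. -/
def loadProg : Prog :=
  .seq (.set 2 (.reg 2 + 1)) <|
  .seq (.set 3 (.reg 2)) <|
  .store 1 (.reg 2) (.cell 1 (.reg 2) + .cell 0 (.reg 2))

/-- One round of the growth algorithm. -/
def roundProg : Prog :=
  .ite (.bin .lt (.cell 4 (.reg 3)) (.cell 1 (.reg 3)))
    (.seq (.set 5 (.cell 4 (.reg 3) + 1)) <|
     .seq (.set 6 ((.reg 5 * .reg 3) % .reg 0)) <|
     .seq (.set 7 (.cell 5 (.reg 6))) <|
     .seq (.set 8 ((.reg 6 * .cell 6 (.reg 7)) % .reg 0)) <|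
     .ite (.bin .lt (.reg 8 - 1) (.cell 4 (.reg 7))) collideProg insertProg)
    loadProg

/-- The growth algorithm. -/
def growProg : Prog :=
  .seq inverseProg (.loop (.bin .lt (.cell 1 (.reg 3)) (.reg 0)) roundProg)

/-- The arrays `7`, …, `11` hold the data of the merges of a list, the last merge first. -/
def LogRep {n : ℕ} (M : ℕ → ℕ → ℕ) : List (Merge n) → Prop
  | [] => True
  | o :: l => (M 7 l.length = o.z.val ∧ M 8 l.length = o.v ∧ M 9 l.length = o.w ∧
      M 10 l.length = o.s ∧ M 11 l.length = o.u) ∧ LogRep M l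

theorem LogRep.congr {n : ℕ} {M M' : ℕ → ℕ → ℕ} {l : List (Merge n)} (h : LogRep M l)
    (hM : ∀ c, 7 ≤ c → ∀ j < l.length, M' c j = M c j) : LogRep M' l := by
  induction l with
  | nil => trivial
  | cons o l ih =>
    refine ⟨?_, ih h.2 fun c hc j hj => hM c hc j (Nat.lt_succ_of_lt hj)⟩
    have hj : l.length < (o :: l).length := Nat.lt_succ_self _
    simp only [hM 7 (by omega) _ hj, hM 8 (by omega) _ hj, hM 9 (by omega) _ hj,
      hM 10 (by omega) _ hj, hM 11 (by omega) _ hj]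
    exact h.1

variable {n : ℕ} {A : Lengths n} {S : State n}

theorem Derives.length_le {A' : Lengths n} {l : List (Merge n)} {g : ZMod n}
    (h : Derives A l A' g) : l.length ≤ undoCost l := by
  induction h with
  | nil => simp
  | cons h ho ih =>
    have := ho.one_le_v
    simp only [undoCost, List.length_cons, List.map_cons, List.sum_cons] at ih ⊢
    omega

variable [Fact n.Prime]

/-- The memory holds the state `S` of the growth algorithm. -/
structure Rep (A : Lengths n) (S : State n) (σ : Store) : Prop where
  n_eq : σ.reg 0 = n
  g_eq : σ.reg 1 = S.g.val
  p_eq : σ.reg 2 = S.p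
  cur_eq : σ.reg 3 = S.cur.val
  len_eq : σ.reg 4 = S.log.length
  A_eq : ∀ i : ZMod n, σ.arr 0 i.val = A i
  L_eq : ∀ i : ZMod n, σ.arr 1 i.val = S.L i
  f_eq : ∀ i : ZMod n, σ.arr 4 i.val = S.f i
  own_eq : ∀ i : ZMod n, σ.arr 5 i.val = (S.own i).val
  inv_eq : ∀ i : ZMod n, σ.arr 6 i.val = (i⁻¹).val
  log_eq : LogRep σ.arr S.log

/-- The words are long enough for the numbers met by the programs. -/
def WordBound (A : Lengths n) (B : ℕ) : Prop := 100 * n ^ 3 + ∑ i, A i < B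

theorem WordBound.bounds {B : ℕ} (hB : WordBound A B) :
    n ≤ n * n ∧ 100 * n < B ∧ 100 * (n * n) < B ∧ 100 * (n * n * n) < B ∧ 100 < B ∧
      ∀ i, 100 * (n * n) + A i < B := by
  have hn : 2 ≤ n := (Fact.out : n.Prime).two_le
  have h1 : n * 1 ≤ n * n := Nat.mul_le_mul_left _ (by omega)
  have h2 : n * n * 1 ≤ n * n * n := Nat.mul_le_mul_left _ (by omega)
  have h3 : n ^ 3 = n * n * n := by ring
  unfold WordBound at hB
  refine ⟨by omega, by omega, by omega, by omega, by omega, fun i => ?_⟩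
  have := Finset.single_le_sum (f := A) (fun _ _ => Nat.zero_le _) (Finset.mem_univ i)
  omega

theorem val_eq_iff {i j : ZMod n} : i.val = j.val ↔ i = j :=
  (ZMod.val_injective n).eq_iff

theorem load_ends {B : ℕ} (hB : WordBound A B) {σ : Store} (hσ : Rep A S σ) (h : S.Inv A)
    (hf : ¬ S.f S.cur < S.L S.cur) (hp : S.p + 1 < n) :
    Ends B loadProg σ loadProg.steps (Rep A (S.load A)) := by
  obtain ⟨b0, b1, b2, b3, b4, b5⟩ := hB.bounds
  have hc : ((S.p + 1 : ℕ) : ZMod n).val = S.p + 1 := ZMod.val_cast_of_lt hp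
  have e1 := hσ.L_eq ((S.p + 1 : ℕ) : ZMod n)
  have e2 := hσ.A_eq ((S.p + 1 : ℕ) : ZMod n)
  have e3 : ∀ i : ZMod n, i.val = S.p + 1 ↔ i = ((S.p + 1 : ℕ) : ZMod n) := by
    intro i; rw [← hc, val_eq_iff, hc]
  have b6 := b5 ((S.p + 1 : ℕ) : ZMod n)
  have b7 : S.L ((S.p + 1 : ℕ) : ZMod n) < n := by
    refine lt_of_le_of_lt (le_of_eq ?_) (h.f_lt ((S.p + 1 : ℕ) : ZMod n))
    by_cases ha : ((S.p + 1 : ℕ) : ZMod n) = S.cur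
    · rw [ha]; have := h.f_le S.cur; omega
    · exact (h.f_eq _ ha).symm
  rw [hc] at e1 e2
  have hp2 := hσ.p_eq
  refine Ends.set_seq (S.p + 1) ?_ ?_ ?_
  · simp [hp2]; omega
  · simp [hp2]
  refine Ends.set_seq (S.p + 1) ?_ ?_ ?_
  · simp; omega
  · simp
  refine Ends.store (S.p + 1) (S.L (S.p + 1 : ℕ) + A (S.p + 1 : ℕ)) ?_ ?_ ?_ ?_ ?_
  · simp; omega
  · simp only [Expr.fits_add, Expr.fits_cell, Expr.fits_reg, Expr.eval_cell, Expr.eval_reg,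
      Store.reg_setReg, Store.arr_setReg, reduceIte, Nat.reduceEqDiff,
      e1, e2]
    omega
  · simp
  · simp [-Nat.cast_add, e1, e2]
  · constructor <;> simp only [State.load, Store.reg_setCell, Store.reg_setReg, Store.arr_setReg,
      Store.arr_setCell, Nat.reduceEqDiff, reduceIte, OfNat.ofNat_ne_one, OfNat.zero_ne_ofNat,
      OfNat.one_ne_ofNat, zero_ne_one]
    · exact hσ.n_eq
    · exact hσ.g_eq
    · exact hc.symm
    · exact hσ.len_eq
    · exact hσ.A_eq
    · intro i
      simp only [Function.update_apply, e3, hσ.L_eq]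
    · exact hσ.f_eq
    · exact hσ.own_eq
    · exact hσ.inv_eq
    · refine hσ.log_eq.congr fun c hc _ _ => ?_
      simp only [Store.arr_setCell, Store.arr_setReg]
      rw [if_neg (by omega)]

/-- The memory also holds the data of the next multiple. -/
structure Rep' (A : Lengths n) (S : State n) (σ : Store) : Prop extends Rep A S σ where
  v_eq : σ.reg 5 = S.v
  y_eq : σ.reg 6 = S.y.val
  b_eq : σ.reg 7 = S.b.val
  w_eq : σ.reg 8 = S.w

theorem insert_ends {B : ℕ} (hB : WordBound A B) {σ : Store} (hσ : Rep' A S σ)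
    (hv : S.v < n) :
    Ends B insertProg σ insertProg.steps (Rep A S.insert) := by
  obtain ⟨b0, b1, b2, b3, b4, b5⟩ := hB.bounds
  have hc := ZMod.val_lt S.cur
  have hy := ZMod.val_lt S.y
  refine Ends.store_seq S.y.val S.cur.val ?_ ?_ ?_ ?_ ?_
  · simp [hσ.y_eq]; omega
  · simp [hσ.cur_eq]; omega
  · simp [hσ.y_eq]
  · simp [hσ.cur_eq]
  refine Ends.store S.cur.val S.v ?_ ?_ ?_ ?_ ?_
  · simp [hσ.cur_eq]; omega
  · simp [hσ.v_eq]; omega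
  · simp [hσ.cur_eq]
  · simp [hσ.v_eq]
  · constructor <;> simp only [State.insert, Store.reg_setCell, Store.arr_setCell,
      Nat.reduceEqDiff, reduceIte, OfNat.zero_ne_ofNat,
      OfNat.one_ne_ofNat]
    · exact hσ.n_eq
    · exact hσ.g_eq
    · exact hσ.p_eq
    · exact hσ.cur_eq
    · exact hσ.len_eq
    · exact hσ.A_eq
    · exact hσ.L_eq
    · intro i
      simp only [Function.update_apply, val_eq_iff, hσ.f_eq]
    · intro i
      simp only [Function.update_apply, val_eq_iff, hσ.own_eq]
      split_ifs <;> rfl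
    · exact hσ.inv_eq
    · refine hσ.log_eq.congr fun c hc _ _ => ?_
      have h1 : c ≠ 4 := by omega
      have h2 : c ≠ 5 := by omega
      simp [h1, h2]

theorem val_mul_mod (a b : ZMod n) : a.val * b.val % n = (a * b).val := (ZMod.val_mul a b).symm

theorem cast_mul_mod (a : ℕ) (b : ZMod n) : a * b.val % n = ((a : ZMod n) * b).val := by
  rw [← ZMod.val_natCast]; push_cast; rw [ZMod.natCast_zmod_val]

theorem collide_ends {B : ℕ} (hB : WordBound A B) {σ : Store} (hσ : Rep' A S σ) (h : S.Inv A)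
    (c : S.Collision) (hL : S.L S.cur < n) :
    Ends B collideProg σ collideProg.steps (Rep A S.collide) := by
  obtain ⟨b0, b1, b2, b3, b4, b5⟩ := hB.bounds
  have hc := ZMod.val_lt S.cur
  have hb := ZMod.val_lt S.b
  have hz := ZMod.val_lt S.merge.z
  have hg := ZMod.val_lt S.g
  have hv := c.v_lt
  have hw := c.w_lt
  have hi := ZMod.val_lt (S.w : ZMod n)⁻¹
  have hLb : S.L S.b < n := by rw [← h.f_eq S.b c.ne.symm]; exact h.f_lt _
  have hfc := h.f_lt S.cur
  have hfb := h.f_lt S.b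
  have hlen' : S.log.length + 1 < B := by
    obtain ⟨A', hd, -⟩ := h.derives
    have := hd.length_le
    have := h.cost_le'
    omega
  have hlen : S.log.length < B := by omega
  have hinv := hσ.inv_eq (S.w : ZMod n)
  rw [ZMod.val_cast_of_lt hw] at hinv
  have m1 : S.cur.val * ((S.w : ZMod n)⁻¹).val ≤ n * n := Nat.mul_le_mul hc.le hi.le
  have m2 : S.L S.cur * S.w ≤ n * n := Nat.mul_le_mul hL.le hw.le
  have m2' : S.L S.b * S.v ≤ n * n := Nat.mul_le_mul hLb.le hv.le
  have m3 : (S.v - 1) * (S.w - 1) ≤ n * n := Nat.mul_le_mul (by omega) (by omega)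
  have m4 : (S.v - 1) * (S.w - 1) * S.merge.z.val ≤ n * n * n := Nat.mul_le_mul m3 hz.le
  have m5 : S.merge.u ≤ 2 * (n * n) :=
    (Nat.sub_le _ _).trans ((Nat.add_le_add m2 m2').trans (by omega))
  have m6 : S.zeroed S.merge.z < n := by
    simp only [State.zeroed, Function.update_apply]
    split_ifs with h1 h2
    · omega
    · omega
    · rw [← h.f_eq _ h2]; exact h.f_lt _
  have m7 : S.cutf S.b < n := by
    simp only [State.cutf, Function.update_of_ne c.ne.symm]; exact hfb
  refine Ends.set_seq (S.L S.cur) ?_ ?_ ?_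
  · simp [hσ.cur_eq, hσ.L_eq]; omega
  · simp [hσ.cur_eq, hσ.L_eq]
  refine Ends.set_seq (S.L S.b) ?_ ?_ ?_
  · simp [hσ.b_eq, hσ.L_eq]; omega
  · simp [hσ.b_eq, hσ.L_eq]
  refine Ends.set_seq S.merge.z.val ?_ ?_ ?_
  · simp [hσ.cur_eq, hσ.w_eq, hinv, hσ.n_eq]; omega
  · simp [hσ.cur_eq, hσ.w_eq, hinv, hσ.n_eq, val_mul_mod, State.merge]
  refine Ends.set_seq S.merge.u ?_ ?_ ?_
  · simp [hσ.v_eq, hσ.w_eq]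
    omega
  · simp [hσ.v_eq, hσ.w_eq, Merge.u, State.merge]
  refine Ends.store_seq S.cur.val 0 ?_ ?_ ?_ ?_ ?_
  · simp [hσ.cur_eq]; omega
  · simp; omega
  · simp [hσ.cur_eq]
  · simp
  refine Ends.store_seq S.b.val 0 ?_ ?_ ?_ ?_ ?_
  · simp [hσ.b_eq]; omega
  · simp; omega
  · simp [hσ.b_eq]
  · simp
  have hz0 : (Function.update (Function.update (σ.arr 1) S.cur.val 0) S.b.val 0) S.merge.z.val
      = S.zeroed S.merge.z := by
    simp only [State.zeroed, Function.update_apply, val_eq_iff, hσ.L_eq]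
  have hb0 : Function.update (σ.arr 4) S.cur.val (S.f S.cur * if S.w = 1 then 1 else 0) S.b.val
      = S.cutf S.b := by
    simp only [State.cutf, Function.update_apply, val_eq_iff, hσ.f_eq]
  refine Ends.store_seq S.merge.z.val (S.zeroed S.merge.z + S.merge.u) ?_ ?_ ?_ ?_ ?_
  · simp; omega
  · simp [hz0]; omega
  · simp
  · simp [hz0]
  refine Ends.store_seq S.cur.val (S.f S.cur * if S.w = 1 then 1 else 0) ?_ ?_ ?_ ?_ ?_
  · simp [hσ.cur_eq]; omega
  · simp [hσ.cur_eq, hσ.w_eq, hσ.f_eq,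
      Expr.fits_eq (show 1 < B by omega)]
    split_ifs <;> omega
  · simp [hσ.cur_eq]
  · simp [hσ.cur_eq, hσ.w_eq, hσ.f_eq]
  refine Ends.store_seq S.b.val (S.cutf S.b * if S.v = 1 then 1 else 0) ?_ ?_ ?_ ?_ ?_
  · simp [hσ.b_eq]; omega
  · simp only [Expr.fits_mul, Expr.fits_eq (show 1 < B by omega)]
    simp [hσ.b_eq, hσ.v_eq]
    simp only [mul_ite, mul_one, mul_zero] at hb0
    rw [hb0]
    split_ifs <;> omega
  · simp [hσ.b_eq]
  · simp [hσ.b_eq, hσ.v_eq, ← hb0]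
  refine Ends.store_seq S.log.length S.merge.z.val ?_ ?_ ?_ ?_ ?_
  · simp [hσ.len_eq, hlen]
  · simp; omega
  · simp [hσ.len_eq]
  · simp
  refine Ends.store_seq S.log.length S.v ?_ ?_ ?_ ?_ ?_
  · simp [hσ.len_eq, hlen]
  · simp [hσ.v_eq]; omega
  · simp [hσ.len_eq]
  · simp [hσ.v_eq]
  refine Ends.store_seq S.log.length S.w ?_ ?_ ?_ ?_ ?_
  · simp [hσ.len_eq, hlen]
  · simp [hσ.w_eq]; omega
  · simp [hσ.len_eq]
  · simp [hσ.w_eq]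
  refine Ends.store_seq S.log.length (S.L S.b) ?_ ?_ ?_ ?_ ?_
  · simp [hσ.len_eq, hlen]
  · simp; omega
  · simp [hσ.len_eq]
  · simp
  refine Ends.store_seq S.log.length S.merge.u ?_ ?_ ?_ ?_ ?_
  · simp [hσ.len_eq, hlen]
  · simp; omega
  · simp [hσ.len_eq]
  · simp
  refine Ends.set_seq (S.log.length + 1) ?_ ?_ ?_
  · simp [hσ.len_eq]; omega
  · simp [hσ.len_eq]
  refine Ends.set_seq (S.g + S.merge.shift).val ?_ ?_ ?_
  · simp [hσ.g_eq, hσ.v_eq, hσ.w_eq, hσ.n_eq]; omega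
  · simp only [Expr.eval_mod, Expr.eval_add, Expr.eval_mul, Expr.eval_sub, Expr.eval_reg,
      Expr.eval_ofNat, Store.reg_setCell, Store.reg_setReg, Nat.reduceEqDiff, reduceIte,
      OfNat.one_ne_ofNat, OfNat.zero_ne_ofNat, hσ.g_eq, hσ.v_eq, hσ.w_eq, hσ.n_eq]
    rw [← ZMod.val_natCast, Nat.cast_add, Nat.cast_mul, ZMod.natCast_zmod_val,
      ZMod.natCast_zmod_val]
    rfl
  refine Ends.set S.merge.z.val ?_ ?_ ?_
  · simp; omega
  · simp
  · constructor <;> simp only [State.collide, Store.reg_setReg, Store.arr_setReg,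
      Store.reg_setCell, Store.arr_setCell, Nat.reduceEqDiff, reduceIte, OfNat.ofNat_ne_one,
      OfNat.zero_ne_ofNat, OfNat.one_ne_ofNat, zero_ne_one, List.length_cons]
    · exact hσ.n_eq
    · exact hσ.p_eq
    · exact hσ.A_eq
    · intro i
      simp only [State.zeroed, Function.update_apply, val_eq_iff, hσ.L_eq]
    · intro i
      simp only [State.cutf, Function.update_apply, val_eq_iff, hσ.f_eq]
    · exact hσ.own_eq
    · exact hσ.inv_eq
    · refine ⟨by simp [State.merge], hσ.log_eq.congr fun c hc j hj => ?_⟩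
      have h1 : c ≠ 1 := by omega
      have h4 : c ≠ 4 := by omega
      have hj : j ≠ S.log.length := by omega
      simp only [Store.arr_setReg, Store.arr_setCell, h1, h4, if_false, Nat.reduceEqDiff, reduceIte,
        OfNat.ofNat_ne_one]
      split_ifs <;> simp [*]

theorem State.Inv.L_lt (h : S.Inv A) (hL : S.L S.cur < n) (i : ZMod n) : S.L i < n := by
  by_cases hi : i = S.cur
  · rwa [hi]
  · rw [← h.f_eq i hi]
    exact h.f_lt i

/-- The loop guard reads the current length once more after the last round, when it may exceed `n`;
this bound and the next one keep it within a word. -/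
theorem State.load_L_cur_le (h : S.Inv A) (hL : S.L S.cur < n) :
    (S.load A).L (S.load A).cur ≤ 3 * (n * n) + A (S.load A).cur := by
  have h1 := h.L_lt hL (S.p + 1 : ℕ)
  have h2 : n ≤ n * n := Nat.le_mul_self n
  simp only [State.load, Function.update_self]
  omega

theorem State.collide_L_cur_le (h : S.Inv A) (c : S.Collision) (hL : S.L S.cur < n) :
    S.collide.L S.collide.cur ≤ 3 * (n * n) := by
  have h1 := h.L_lt hL
  have h2 : n ≤ n * n := Nat.le_mul_self n
  have h3 := c.L_add S.merge.z
  have h4 : S.L S.cur * S.w ≤ n * n := Nat.mul_le_mul hL.le c.w_lt.le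
  have h5 : S.L S.b * S.v ≤ n * n := Nat.mul_le_mul (h1 _).le c.v_lt.le
  have h6 : S.merge.u ≤ S.L S.cur * S.w + S.L S.b * S.v := Nat.sub_le _ _
  have h7 := h1 S.merge.z
  rw [Pi.single_eq_same] at h3
  change S.collide.L S.merge.z ≤ _
  omega

theorem round_ends {B : ℕ} (hB : WordBound A B) {σ : Store} (hσ : Rep A S σ) (h : S.Inv A)
    (hA : n ≤ ∑ i, if i = 0 then 0 else A i) (hL : S.L S.cur < n) :
    Ends B roundProg σ roundProg.steps fun τ =>
      ∃ S' : State n, (S'.Inv A ∧ Rep A S' τ ∧ S'.L S'.cur ≤ 3 * (n * n) + A S'.cur) ∧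
        S.progress + 1 ≤ S'.progress := by
  obtain ⟨b0, b1, b2, b3, b4, b5⟩ := hB.bounds
  have hc := ZMod.val_lt S.cur
  have hfc := h.f_lt S.cur
  have hy := ZMod.val_lt S.y
  have hb := ZMod.val_lt S.b
  have hfb := h.f_lt S.b
  have hi := ZMod.val_lt (S.b)⁻¹
  have hw : S.w < n := ZMod.val_lt _
  refine Ends.ite ?_ (fun hf => ?_) fun hf => ?_
  · simp [Expr.fits_lt (show 1 < B by omega), hσ.cur_eq, hσ.f_eq, hσ.L_eq]
    omega
  · have hf : S.f S.cur < S.L S.cur := by simpa [hσ.cur_eq, hσ.f_eq, hσ.L_eq] using hf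
    have hv : S.v < n := by unfold State.v; omega
    have m1 : S.v * S.cur.val ≤ n * n := Nat.mul_le_mul hv.le hc.le
    have m2 : S.y.val * (S.b)⁻¹.val ≤ n * n := Nat.mul_le_mul hy.le hi.le
    refine Ends.set_seq S.v ?_ ?_ ?_
    · simp [hσ.cur_eq, hσ.f_eq]; omega
    · simp [hσ.cur_eq, hσ.f_eq, State.v]
    refine Ends.set_seq S.y.val ?_ ?_ ?_
    · simp [hσ.cur_eq, hσ.n_eq]; omega
    · simp [hσ.cur_eq, hσ.n_eq, cast_mul_mod, State.y]
    refine Ends.set_seq S.b.val ?_ ?_ ?_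
    · simp [hσ.own_eq]
      change _ ∧ S.b.val < B
      omega
    · simp [hσ.own_eq, State.b]
    refine Ends.set_seq S.w ?_ ?_ ?_
    · simp [hσ.inv_eq, hσ.n_eq]; omega
    · simp [hσ.inv_eq, hσ.n_eq, val_mul_mod, State.w]
    have hσ' : Rep' A S ((((σ.setReg 5 S.v).setReg 6 S.y.val).setReg 7 S.b.val).setReg 8 S.w) := by
      refine ⟨⟨?_, ?_, ?_, ?_, ?_, hσ.A_eq, hσ.L_eq, hσ.f_eq, hσ.own_eq, hσ.inv_eq, hσ.log_eq⟩,
        ?_, ?_, ?_, ?_⟩ <;> simp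
      exacts [hσ.n_eq, hσ.g_eq, hσ.p_eq, hσ.cur_eq, hσ.len_eq]
    refine Ends.ite ?_ (fun hw => ?_) fun hw => ?_
    · simp [Expr.fits_lt (show 1 < B by omega), hσ.f_eq]
      omega
    · have hw : S.w - 1 < S.f S.b := by simpa [hσ.f_eq] using hw
      have hI := h.collide hL hf hw
      exact (collide_ends hB hσ' h (h.collision hL hf hw) hL).mono le_rfl
        fun τ hτ => ⟨_, ⟨hI.1, hτ, (State.collide_L_cur_le h (h.collision hL hf hw) hL).trans
          (Nat.le_add_right _ _)⟩, hI.2⟩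
    · have hw : ¬ S.w - 1 < S.f S.b := by simpa [hσ.f_eq] using hw
      have hI := h.insert hL hf hw
      refine (insert_ends hB hσ' hv).mono le_rfl fun τ hτ =>
        ⟨_, ⟨hI.1, hτ, ?_⟩, hI.2.ge⟩
      change S.L S.cur ≤ 3 * (n * n) + A S.cur
      omega
  · have hf : ¬ S.f S.cur < S.L S.cur := by simpa [hσ.cur_eq, hσ.f_eq, hσ.L_eq] using hf
    have hI := h.load hA hf
    exact (load_ends hB hσ h hf (h.p_succ_lt hA hf)).mono le_rfl fun τ hτ =>
      ⟨_, ⟨hI.1, hτ, State.load_L_cur_le h hL⟩, hI.2⟩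

/-- Reducing `n = (n / i) * i + n % i` modulo `n` gives `i⁻¹ = -(n / i) * (n % i)⁻¹`, and `n % i` is
nonzero because `n` is prime. All inverses are thus found in linear time. -/
theorem inverse_recurrence {i : ℕ} (hi : 2 ≤ i) (hin : i < n) :
    (n - n / i * ((n % i : ℕ) : ZMod n)⁻¹.val % n) % n = ((i : ZMod n)⁻¹).val := by
  have hr1 : n % i ≠ 0 := by
    intro h0
    have := ((Fact.out : n.Prime).dvd_iff_eq (by omega)).mp (Nat.dvd_of_mod_eq_zero h0)
    omega
  have hr : ((n % i : ℕ) : ZMod n) ≠ 0 :=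
    natCast_ne_zero (by omega) ((Nat.mod_lt _ (by omega)).trans hin)
  have hi0 : (i : ZMod n) ≠ 0 := natCast_ne_zero (by omega) hin
  have hlt := Nat.mod_lt (n / i * ((n % i : ℕ) : ZMod n)⁻¹.val) (by omega : 0 < n)
  rw [← ZMod.val_natCast]
  congr 1
  rw [Nat.cast_sub hlt.le, ZMod.natCast_self, ZMod.natCast_mod, Nat.cast_mul,
    ZMod.natCast_zmod_val]
  have hn := congrArg (Nat.cast : ℕ → ZMod n) (Nat.div_add_mod n i)
  rw [Nat.cast_add, Nat.cast_mul, ZMod.natCast_self] at hn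
  field_simp
  linear_combination -hn

/-- The memory while the table of inverses is computed, up to `i`. -/
structure InverseRep (A : Lengths n) (i : ℕ) (σ : Store) : Prop where
  two_le : 2 ≤ i
  le : i ≤ n
  n_eq : σ.reg 0 = n
  i_eq : σ.reg 5 = i
  reg_eq : ∀ x, x ≠ 0 → x ≠ 5 → σ.reg x = 0
  A_eq : ∀ i : ZMod n, σ.arr 0 i.val = A i
  arr_eq : ∀ a, a ≠ 0 → a ≠ 6 → ∀ j, σ.arr a j = 0
  inv_eq : ∀ j < i, σ.arr 6 j = ((j : ZMod n)⁻¹).val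

theorem inverseStep_ends {B i : ℕ} (hB : WordBound A B) {σ : Store} (h : InverseRep A i σ)
    (hin : i < n) :
    Ends B inverseStep σ inverseStep.steps (InverseRep A (i + 1)) := by
  obtain ⟨b0, b1, b2, b3, b4, b5⟩ := hB.bounds
  have h2 := h.two_le
  have hmod : n % i < i := Nat.mod_lt _ (by omega)
  have hinv := h.inv_eq _ hmod
  have hr := ZMod.val_lt ((n % i : ℕ) : ZMod n)⁻¹
  have m1 : n / i * ((n % i : ℕ) : ZMod n)⁻¹.val ≤ n * n :=
    Nat.mul_le_mul (Nat.div_le_self _ _) hr.le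
  have hrec := inverse_recurrence h2 hin
  refine Ends.store_seq i ((i : ZMod n)⁻¹).val ?_ ?_ ?_ ?_ ?_
  · simp [h.i_eq]; omega
  · simp only [Expr.fits_mod, Expr.fits_sub, Expr.fits_mul, Expr.fits_div, Expr.fits_cell,
      Expr.fits_reg, Expr.eval_reg, Expr.eval_cell, Expr.eval_mod, Expr.eval_div, h.n_eq, h.i_eq,
      hinv]
    omega
  · simp [h.i_eq]
  · simp only [Expr.eval_sub, Expr.eval_mul, Expr.eval_reg, Expr.eval_cell, Expr.eval_mod,
      Expr.eval_div, h.n_eq, h.i_eq, hinv, hrec]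
  refine Ends.set (i + 1) ?_ ?_ ?_
  · simp [h.i_eq]; omega
  · simp [h.i_eq]
  · constructor
    · omega
    · omega
    · simp [h.n_eq]
    · simp
    · intro x h0 h5
      simp [h5, h.reg_eq x h0 h5]
    · simpa using h.A_eq
    · intro a h0 h6 j
      simp [h6, h.arr_eq a h0 h6]
    · intro j hj
      simp only [Store.arr_setReg, Store.arr_setCell, reduceIte, Function.update_apply]
      split_ifs with hji
      · rw [hji]
      · exact h.inv_eq j (by omega)

theorem table_val (f : ZMod n → ℕ) (i : ZMod n) : table f i.val = f i := by
  simp [table, ZMod.val_lt]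

theorem inverse_ends {B : ℕ} (hB : WordBound A B) :
    Ends B inverseProg (inputStore A) (100 * n) (Rep A (State.init n)) := by
  obtain ⟨b0, b1, b2, b3, b4, b5⟩ := hB.bounds
  have hn : 2 ≤ n := (Fact.out : n.Prime).two_le
  have : Fact (1 < n) := ⟨hn⟩
  have h2 : InverseRep A 2 (((inputStore A).setCell 6 1 1).setReg 5 2) := by
    constructor
    · rfl
    · exact hn
    · simp [inputStore]
    · simp
    · intro x h0 h5
      simp [h0, h5, inputStore]
    · intro i
      simp [inputStore, table_val]
    · intro a h0 h6 j
      simp [h0, h6, inputStore]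
    -- The untouched cell `0` agrees with the convention `0⁻¹ = 0`, which matters for lookups of
    -- residues whose owner is still the default `0`.
    · intro j hj
      interval_cases j <;> simp [inputStore, ZMod.val_one]
  refine Ends.mono (T₁ := (Prog.store 6 1 1).steps + ((Prog.set 5 2).steps + _))
    (.seq (.store 1 1 ?_ ?_ ?_ ?_ (.seq (.set 2 ?_ ?_
    (.loop (InverseRep A) (fun i => n - i) inverseStep.steps ?_ ?_ 2 h2))))) ?_ ?_
  · simp; omega
  · simp; omega
  · simp
  · simp
  · simp; omega
  · simp
  · intro i σ h
    have := h.le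
    simp [Expr.fits_lt (show 1 < B by omega), h.n_eq, h.i_eq]
    omega
  · intro i σ h hi
    have hin : i < n := by simpa [h.n_eq, h.i_eq] using hi
    exact (inverseStep_ends hB h hin).mono le_rfl fun τ hτ => ⟨_, hτ, by omega⟩
  · have e1 : inverseStep.steps + (Expr.bin .lt (.reg 5) (.reg 0)).cost + 1 ≤ 30 := by decide
    have e2 : (Prog.store 6 1 1).steps + ((Prog.set 5 2).steps
      + ((Expr.bin .lt (.reg 5) (.reg 0)).cost + 1)) ≤ 30 := by decide
    have := Nat.mul_le_mul_left (n - 2) e1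
    omega
  · rintro τ ⟨i, h, hi⟩
    have hin : n ≤ i := by simpa [h.n_eq, h.i_eq] using hi
    have hin : i = n := le_antisymm h.le hin
    subst hin
    refine ⟨h.n_eq, ?_, ?_, ?_, ?_, h.A_eq, ?_, ?_, ?_, ?_, trivial⟩
    · simp [h.reg_eq 1, State.init]
    · simp [h.reg_eq 2, State.init]
    · simp [h.reg_eq 3, State.init]
    · simp [h.reg_eq 4, State.init]
    · simp [h.arr_eq 1, State.init]
    · simp [h.arr_eq 4, State.init]
    · simp [h.arr_eq 5, State.init]
    · intro j
      rw [h.inv_eq _ (ZMod.val_lt j), ZMod.natCast_zmod_val]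

theorem grow_ends {B : ℕ} (hB : WordBound A B) (hA : n ≤ ∑ i, if i = 0 then 0 else A i) :
    Ends B growProg (inputStore A) (3000 * n) fun τ =>
      ∃ S : State n, (S.Inv A ∧ Rep A S τ ∧ S.L S.cur ≤ 3 * (n * n) + A S.cur) ∧
        n ≤ S.L S.cur := by
  obtain ⟨b0, b1, b2, b3, b4, b5⟩ := hB.bounds
  have hn : 2 ≤ n := (Fact.out : n.Prime).two_le
  have hcond : ∀ S : State n, ∀ σ, Rep A S σ →
      ((Expr.bin .lt (.cell 1 (.reg 3)) (.reg 0)).eval σ = 0 ↔ n ≤ S.L S.cur) := by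
    intro S σ h
    simp [h.cur_eq, h.L_eq, h.n_eq]
  refine Ends.mono (.seq ((inverse_ends hB).mono le_rfl fun σ hσ =>
    .loop (fun (S : State n) τ => S.Inv A ∧ Rep A S τ ∧ S.L S.cur ≤ 3 * (n * n) + A S.cur)
      (fun S => 8 * n + 1 - S.progress) roundProg.steps ?_ ?_ (State.init n)
      ⟨State.init_inv A, hσ, ?_⟩)) ?_ ?_
  · rintro S σ ⟨-, h, hle⟩
    have := b5 S.cur
    have := ZMod.val_lt S.cur
    simp [Expr.fits_lt (show 1 < B by omega), h.n_eq, h.cur_eq, h.L_eq]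
    omega
  · rintro S σ ⟨hI, h, hle⟩ hc
    have hL : S.L S.cur < n := by
      rw [Ne, hcond S σ h] at hc
      omega
    have hp := hI.progress_le hL
    exact (round_ends hB h hI hA hL).mono le_rfl fun τ ⟨S', h', hlt⟩ => ⟨S', h', by omega⟩
  · simp [State.init]
  -- At most `8 * n + 1` rounds of at most 200 steps, after the `100 * n` steps for the inverses.
  · have e1 : roundProg.steps + (Expr.bin .lt (.cell 1 (.reg 3)) (.reg 0)).cost + 1 ≤ 200 := by
      decide
    have e2 : (Expr.bin .lt (.cell 1 (.reg 3)) (.reg 0)).cost + 1 ≤ 10 := by decide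
    have := Nat.mul_le_mul (Nat.sub_le (8 * n + 1) (State.init n).progress) e1
    omega
  · rintro τ ⟨S, h, hc⟩
    exact ⟨S, h, (hcond S τ h.2.1).mp hc⟩

end APSum
namespace APSum

/-! ### The recovery program and its correctness. -/

/-- The data of the last merge are read, and the multiple of the new difference is removed. -/
def readProg : Prog :=
  .seq (.set 4 (.reg 4 - 1)) <|
  .seq (.set 9 (.cell 7 (.reg 4))) <|
  .seq (.set 5 (.cell 8 (.reg 4))) <|
  .seq (.set 8 (.cell 9 (.reg 4))) <|
  .seq (.set 12 (.cell 10 (.reg 4))) <|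
  .seq (.set 10 (.cell 11 (.reg 4))) <|
  .seq (.set 6 (.cell 3 (.reg 9) - (.cell 3 (.reg 9) - .reg 10))) <|
  .seq (.store 3 (.reg 9) (.cell 3 (.reg 9) - .reg 6)) <|
  .seq (.set 6 (.reg 6 + (.reg 5 - 1) * (.reg 8 - 1))) <|
  .set 7 ((.reg 6 - .reg 12 * .reg 5 + (.reg 8 - 1)) / .reg 8)

/-- The removed multiple is split. -/
def splitProg : Prog :=
  .loop ((.reg 6 - .reg 7 * .reg 8) % .reg 5) (.set 7 (.reg 7 + 1))

/-- The multiples of the two old differences are added. -/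
def addProg : Prog :=
  .seq (.set 11 ((.reg 8 * .reg 9) % .reg 0)) <|
  .seq (.store 3 (.reg 11) (.cell 3 (.reg 11) + .reg 7)) <|
  .seq (.set 11 ((.reg 5 * .reg 9) % .reg 0)) <|
  .store 3 (.reg 11) (.cell 3 (.reg 11) + (.reg 6 - .reg 7 * .reg 8) / .reg 5)

/-- The last merge is undone. -/
def undoProg : Prog := .seq readProg (.seq splitProg addProg)

/-- The next cell of the given construction is copied. -/
def copyStep : Prog :=
  .seq (.store 3 (.reg 5) (.cell 2 (.reg 5))) <|
  .set 5 (.reg 5 + 1)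

/-- A construction after the growth algorithm is turned into one before it. -/
def recoverProg : Prog :=
  .seq (.seq (.set 5 0) (.loop (.bin .lt (.reg 5) (.reg 0)) copyStep))
    (.loop (.reg 4) undoProg)

variable {n : ℕ} {A A' : Lengths n}

/-- The memory holds the construction `m` and the list of the merges to be undone. -/
structure UndoRep (l : List (Merge n)) (m : ZMod n → ℕ) (σ : Store) : Prop where
  n_eq : σ.reg 0 = n
  len_eq : σ.reg 4 = l.length
  m_eq : ∀ i : ZMod n, σ.arr 3 i.val = m i
  log_eq : LogRep σ.arr l

namespace Merge
variable (o : Merge n) (m : ZMod n → ℕ)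

/-- The number to be split when the merge is undone. -/
def target : ℕ := min (m o.z) o.u + (o.v - 1) * (o.w - 1)

/-- The first candidate for the split. -/
def start : ℕ := (o.target m - o.s * o.v + (o.w - 1)) / o.w

/-- The construction without the multiple of the new difference. -/
def removed : ZMod n → ℕ := Function.update m o.z (m o.z - min (m o.z) o.u)

theorem removed_le (i : ZMod n) : o.removed m i ≤ m i := by
  simp only [removed, Function.update_apply]
  split_ifs with h
  · rw [h]; exact Nat.sub_le _ _
  · exact le_rfl

theorem Valid.u_le {o : Merge n} (ho : o.Valid A') : o.u ≤ 2 * (n * n) := by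
  have h4 : o.t * o.w ≤ n * n := Nat.mul_le_mul ho.t_lt.le ho.w_lt.le
  have h5 : o.s * o.v ≤ n * n := Nat.mul_le_mul ho.s_lt.le ho.v_lt.le
  have h6 : o.u ≤ o.t * o.w + o.s * o.v := Nat.sub_le _ _
  omega

theorem Valid.target_le {o : Merge n} (ho : o.Valid A') (m : ZMod n → ℕ) :
    o.target m ≤ 3 * (n * n) := by
  have h1 : (o.v - 1) * (o.w - 1) ≤ n * n :=
    Nat.mul_le_mul ((Nat.sub_le _ _).trans ho.v_lt.le) ((Nat.sub_le _ _).trans ho.w_lt.le)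
  have h2 := ho.u_le
  have h3 : min (m o.z) o.u ≤ o.u := min_le_right _ _
  unfold target
  omega

end Merge

theorem update_add_le (m : ZMod n → ℕ) (a : ZMod n) (q : ℕ) (i : ZMod n) :
    Function.update m a (m a + q) i ≤ m i + q := by
  rw [Function.update_apply]
  split_ifs with h
  · rw [h]
  · exact Nat.le_add_right _ _

/-- The memory holds the numbers for the split, with `q` as the current candidate. -/
structure SplitRep (o : Merge n) (l : List (Merge n)) (m : ZMod n → ℕ) (q : ℕ) (σ : Store) :
    Prop extends UndoRep l (o.removed m) σ where
  z_eq : σ.reg 9 = o.z.val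
  v_eq : σ.reg 5 = o.v
  w_eq : σ.reg 8 = o.w
  N_eq : σ.reg 6 = o.target m
  q_eq : σ.reg 7 = q

variable [Fact n.Prime]

theorem read_ends {B : ℕ} (hB : WordBound A B) {o : Merge n} {l : List (Merge n)}
    {m : ZMod n → ℕ} {σ : Store} (ho : o.Valid A') (hσ : UndoRep (o :: l) m σ)
    (hl : l.length + 1 < B) (hm : ∀ i, m i < B) :
    Ends B readProg σ readProg.steps (SplitRep o l m (o.start m)) := by
  obtain ⟨b0, b1, b2, b3, b4, b5⟩ := hB.bounds
  have hz := ZMod.val_lt o.z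
  have hmz := hm o.z
  have hv := ho.v_lt
  have hw := ho.w_lt
  have hs := ho.s_lt
  have hu := ho.u_le
  have hN := ho.target_le m
  have hlen := hσ.len_eq
  rw [List.length_cons] at hlen
  obtain ⟨⟨l7, l8, l9, l10, l11⟩, hlog⟩ := hσ.log_eq
  have hsub : m o.z - (m o.z - o.u) = min (m o.z) o.u := by omega
  have hmin : min (m o.z) o.u ≤ o.u := min_le_right _ _
  have m1 : (o.v - 1) * (o.w - 1) ≤ n * n := Nat.mul_le_mul (by omega) (by omega)
  have m2 : o.s * o.v ≤ n * n := Nat.mul_le_mul (by omega) (by omega)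
  refine Ends.set_seq l.length ?_ ?_ ?_
  · simp [hlen]; omega
  · simp [hlen]
  refine Ends.set_seq o.z.val ?_ ?_ ?_
  · simp [l7]; omega
  · simp [l7]
  refine Ends.set_seq o.v ?_ ?_ ?_
  · simp [l8]; omega
  · simp [l8]
  refine Ends.set_seq o.w ?_ ?_ ?_
  · simp [l9]; omega
  · simp [l9]
  refine Ends.set_seq o.s ?_ ?_ ?_
  · simp [l10]; omega
  · simp [l10]
  refine Ends.set_seq o.u ?_ ?_ ?_
  · simp [l11]; omega
  · simp [l11]
  refine Ends.set_seq (min (m o.z) o.u) ?_ ?_ ?_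
  · simp [hσ.m_eq]; omega
  · simpa [hσ.m_eq] using hsub
  refine Ends.store_seq o.z.val (m o.z - min (m o.z) o.u) ?_ ?_ ?_ ?_ ?_
  · simp; omega
  · simp only [Expr.fits_sub, Expr.fits_cell, Expr.fits_reg, Expr.eval_reg, Store.reg_setReg,
      Store.arr_setReg, Nat.reduceEqDiff, reduceIte, hσ.m_eq]
    omega
  · simp
  · simp [hσ.m_eq]
  refine Ends.set_seq (o.target m) ?_ ?_ ?_
  · simp only [Expr.fits_sub, Expr.fits_add, Expr.fits_mul, Expr.fits_reg, Expr.eval_reg,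
      Expr.eval_sub, Expr.eval_mul, Expr.eval_ofNat, Expr.fits_ofNat, Store.reg_setReg,
      Store.reg_setCell, Nat.reduceEqDiff, reduceIte]
    omega
  · simp [Merge.target]
  refine Ends.set (o.start m) ?_ ?_ ?_
  · simp
    omega
  · simp [Merge.start]
  · constructor
    · constructor
      · simp [hσ.n_eq]
      · simp
      · intro i
        simp only [Merge.removed, Store.arr_setReg, Store.arr_setCell, reduceIte,
          Function.update_apply, val_eq_iff, hσ.m_eq]
      · refine hlog.congr fun c hc _ _ => ?_
        simp only [Store.arr_setCell, Store.arr_setReg]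
        rw [if_neg (by omega)]
    all_goals simp

theorem split_ends {B : ℕ} (hB : WordBound A B) {o : Merge n} {l : List (Merge n)}
    {m : ZMod n → ℕ} {σ : Store} (ho : o.Valid A') (hσ : SplitRep o l m (o.start m) σ) :
    Ends B splitProg σ (30 * o.v + 30) fun τ => ∃ q r, SplitRep o l m q τ ∧ q ≤ o.t ∧ r ≤ o.s ∧
      q * o.w + r * o.v = o.target m := by
  obtain ⟨b0, b1, b2, b3, b4, b5⟩ := hB.bounds
  have hv := ho.v_lt
  have hw := ho.w_lt
  have ht := ho.t_lt
  have hN := ho.target_le m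
  have hN1 : (o.v - 1) * (o.w - 1) ≤ o.target m := Nat.le_add_left _ _
  have hN2 : o.target m + (o.v - 1) * (o.w - 1) ≤ o.t * o.w + o.s * o.v := by
    have := merge_length_eq ho.one_le_v ho.one_le_w ho.v_le ho.w_le
    have : min (m o.z) o.u ≤ o.u := min_le_right _ _
    unfold Merge.target Merge.u at *
    omega
  obtain ⟨j₀, r₀, hj, hjt, hjr⟩ := exists_split ho.one_le_v ho.one_le_w ho.coprime ho.v_le ho.w_le
    hN1 hN2
  change o.start m + j₀ ≤ o.t at hjt
  change (o.start m + j₀) * o.w + _ = _ at hjr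
  -- Up to the candidate `j₀` the truncated subtraction in the loop condition is a true subtraction,
  -- so remainder zero really means divisibility.
  have hle : ∀ j ≤ j₀, (o.start m + j) * o.w ≤ o.target m := fun j hj =>
    (Nat.mul_le_mul_right _ (Nat.add_le_add_left hj _)).trans
      (by rw [← hjr]; exact Nat.le_add_right _ _)
  refine (Ends.loop (fun j τ => SplitRep o l m (o.start m + j) τ ∧ j ≤ j₀) (fun j => j₀ - j)
    (Prog.set 7 (.reg 7 + 1)).steps ?_ ?_ 0 ⟨hσ, Nat.zero_le _⟩).mono ?_ ?_
  · rintro j τ ⟨h, hj'⟩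
    have := hle j hj'
    simp [h.N_eq, h.q_eq, h.w_eq, h.v_eq]
    omega
  · rintro j τ ⟨h, hj'⟩ hc
    have hne : j ≠ j₀ := by
      rintro rfl
      simp only [Expr.eval_mod, Expr.eval_sub, Expr.eval_mul, Expr.eval_reg, h.N_eq, h.q_eq,
        h.w_eq, h.v_eq, ← hjr] at hc
      apply hc
      rw [Nat.add_sub_cancel_left, Nat.mul_mod_left]
    refine Ends.set (o.start m + (j + 1)) ?_ ?_ ⟨j + 1, ⟨?_, ?_⟩, ?_⟩
    · simp [h.q_eq]; omega
    · simp [h.q_eq, add_assoc]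
    · refine ⟨⟨?_, ?_, h.m_eq, h.log_eq⟩, ?_, ?_, ?_, ?_, ?_⟩ <;> simp
      exacts [h.n_eq, h.len_eq, h.z_eq, h.v_eq, h.w_eq, h.N_eq]
    · omega
    · omega
  · have e1 : (Prog.set 7 (.reg 7 + 1)).steps
      + ((.reg 6 - .reg 7 * .reg 8) % .reg 5 : Expr).cost + 1 ≤ 30 := by decide
    have := Nat.mul_le_mul (show j₀ - 0 ≤ o.v by omega) e1
    omega
  · rintro τ ⟨j, ⟨h, hj'⟩, hc⟩
    simp only [Expr.eval_mod, Expr.eval_sub, Expr.eval_mul, Expr.eval_reg, h.N_eq, h.q_eq,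
        h.w_eq, h.v_eq] at hc
    have hd := Nat.div_mul_cancel (Nat.dvd_of_mod_eq_zero hc)
    have hj1 := hle j hj'
    -- The loop may stop before `j₀`. Then `q ≤ t` holds since `q` is not larger than the candidate
    -- for `j₀`, and `r ≤ s` by the choice of `start`.
    refine ⟨_, _, h, by omega, ?_, by rw [hd]; omega⟩
    have h1 : o.target m ≤ o.start m * o.w + o.s * o.v := le_split ho.one_le_w
    have h2 : o.start m * o.w ≤ (o.start m + j) * o.w := Nat.mul_le_mul_right _ (by omega)
    exact Nat.div_le_of_le_mul (by rw [Nat.mul_comm o.v]; omega)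

theorem add_ends {B : ℕ} (hB : WordBound A B) {o : Merge n} {l : List (Merge n)}
    {m m₂ : ZMod n → ℕ} {q r : ℕ} {σ : Store} (ho : o.Valid A') (hσ : SplitRep o l m q σ)
    (hm : ∀ i, m i + 2 * n < B) (hq : q ≤ o.t) (hr : r ≤ o.s)
    (hqr : q * o.w + r * o.v = o.target m)
    (h₂ : m₂ = Function.update (o.removed m) o.a (o.removed m o.a + q)) :
    Ends B addProg σ addProg.steps (UndoRep l (Function.update m₂ o.b (m₂ o.b + r))) := by
  obtain ⟨b0, b1, b2, b3, b4, b5⟩ := hB.bounds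
  have hz := ZMod.val_lt o.z
  have ha := ZMod.val_lt o.a
  have hb := ZMod.val_lt o.b
  have hv := ho.v_lt
  have hw := ho.w_lt
  have hs := ho.s_lt
  have ht := ho.t_lt
  have hN := ho.target_le m
  have hle := o.removed_le m
  have hle₂ : ∀ i, m₂ i ≤ m i + q := by
    intro i
    rw [h₂]
    exact (update_add_le _ _ _ _).trans (Nat.add_le_add_right (hle i) _)
  have m1 : o.w * o.z.val ≤ n * n := Nat.mul_le_mul hw.le hz.le
  have m2 : o.v * o.z.val ≤ n * n := Nat.mul_le_mul hv.le hz.le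
  have ha1 := hle o.a
  have ha2 := hm o.a
  have hb1 := hle₂ o.b
  have hb2 := hm o.b
  have hdiv : (o.target m - q * o.w) / o.v = r := by
    rw [← hqr, Nat.add_sub_cancel_left, Nat.mul_div_cancel _ ho.one_le_v]
  have hm₂ : ∀ i : ZMod n,
      Function.update (σ.arr 3) o.a.val (o.removed m o.a + q) i.val = m₂ i := by
    intro i
    simp only [h₂, Function.update_apply, val_eq_iff, hσ.m_eq]
  refine Ends.set_seq o.a.val ?_ ?_ ?_
  · simp [hσ.z_eq, hσ.w_eq, hσ.n_eq]; omega
  · simp [hσ.z_eq, hσ.w_eq, hσ.n_eq, cast_mul_mod, Merge.a]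
  refine Ends.store_seq o.a.val (o.removed m o.a + q) ?_ ?_ ?_ ?_ ?_
  · simp; omega
  · simp [hσ.m_eq, hσ.q_eq]; omega
  · simp
  · simp [hσ.m_eq, hσ.q_eq]
  refine Ends.set_seq o.b.val ?_ ?_ ?_
  · simp [hσ.z_eq, hσ.v_eq, hσ.n_eq]; omega
  · simp [hσ.z_eq, hσ.v_eq, hσ.n_eq, cast_mul_mod, Merge.b]
  refine Ends.store o.b.val (m₂ o.b + r) ?_ ?_ ?_ ?_ ?_
  · simp; omega
  · simp only [Expr.fits_sub, Expr.fits_add, Expr.fits_mul, Expr.fits_div, Expr.fits_cell,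
      Expr.fits_reg, Expr.eval_reg, Expr.eval_cell, Expr.eval_sub, Expr.eval_mul, Expr.eval_div,
      Store.reg_setReg, Store.reg_setCell, Store.arr_setReg, Store.arr_setCell, Nat.reduceEqDiff,
      reduceIte, hσ.N_eq, hσ.q_eq, hσ.w_eq, hσ.v_eq, hm₂, hdiv]
    omega
  · simp
  · simp only [Expr.eval_add, Expr.eval_reg, Expr.eval_cell, Expr.eval_sub, Expr.eval_mul,
      Expr.eval_div,
      Store.reg_setReg, Store.reg_setCell, Store.arr_setReg, Store.arr_setCell, Nat.reduceEqDiff,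
      reduceIte, hσ.N_eq, hσ.q_eq, hσ.w_eq, hσ.v_eq, hm₂, hdiv]
  · constructor
    · simp [hσ.n_eq]
    · simp [hσ.len_eq]
    · intro i
      simp only [Store.arr_setReg, Store.arr_setCell, reduceIte]
      rw [Function.update_apply, hm₂, Function.update_apply]
      simp only [val_eq_iff]
    · refine hσ.log_eq.congr fun c hc _ _ => ?_
      have : c ≠ 3 := by omega
      simp [this]

theorem undo_ends {B : ℕ} (hB : WordBound A B) {o : Merge n} {l : List (Merge n)}
    {m : ZMod n → ℕ} {x : ZMod n} {σ : Store} (ho : o.Valid A') (hσ : UndoRep (o :: l) m σ)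
    (hl : l.length + 1 < B) (hm : ∀ i, m i + 2 * n < B) (hx : IsConstruction (o.apply A') m x) :
    Ends B undoProg σ (200 + 30 * o.v) fun τ => ∃ m', UndoRep l m' τ ∧
      IsConstruction A' m' (x + o.shift) ∧ ∀ i, m' i ≤ m i + 2 * n := by
  refine Ends.mono (.seq ((read_ends hB ho hσ hl fun i => by have := hm i; omega).mono le_rfl
    fun τ hτ => .seq ((split_ends hB ho hτ).mono le_rfl fun υ ⟨q, r, hυ, hq, hr, hqr⟩ =>
      (add_ends hB ho hυ hm hq hr hqr rfl).mono le_rfl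
        fun ω hω => ⟨_, hω, hx.undo ho hq hr hqr rfl rfl, ?_⟩))) ?_ fun _ h => h
  · have e1 : readProg.steps + addProg.steps ≤ 150 := by decide
    omega
  · intro i
    have := ho.t_lt
    have := ho.s_lt
    have h1 := o.removed_le m i
    have h2 := update_add_le (o.removed m) o.a q i
    have h3 := update_add_le (Function.update (o.removed m) o.a (o.removed m o.a + q)) o.b r i
    omega

/-- Undoing a merge raises a multiplicity by at most `q + r ≤ 2 * n`, so `K` is a word bound that
lasts for the whole list. The constant overhead per merge is absorbed into the cost because `v ≥ 1`.
-/
theorem undo_loop_ends {B K : ℕ} (hB : WordBound A B) (hK : K + 2 * n < B)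
    {l : List (Merge n)} {g : ZMod n} (h : Derives A l A' g) {m : ZMod n → ℕ} {x : ZMod n}
    (hx : IsConstruction A' m x) {σ : Store} (hσ : UndoRep l m σ) (hl : l.length < B)
    (hm : ∀ i, m i + 2 * n * l.length ≤ K) :
    Ends B (.loop (.reg 4) undoProg) σ (240 * undoCost l + 2) fun τ =>
      IsConstruction A (fun i => τ.arr 3 i.val) (x + g) := by
  induction h generalizing m x σ with
  | nil =>
    refine Ends.mono (.loop_done ?_ ?_ ?_) le_rfl fun _ h => h
    · simpa [hσ.len_eq] using hl
    · simp [hσ.len_eq]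
    · simpa only [hσ.m_eq, add_zero] using hx
  | @cons o l A' g h ho ih =>
    simp only [List.length_cons] at hl hm
    refine Ends.mono (.loop_step (T₂ := 240 * undoCost l + 2) ?_ ?_
      ((undo_ends hB ho hσ hl (fun i => by have := hm i; nlinarith) hx).mono le_rfl
        fun τ ⟨m', hτ, hx', hm'⟩ => (ih hx' hτ (by omega) fun i => ?_).mono le_rfl
          fun υ hυ => ?_)) ?_ fun _ h => h
    · simpa [hσ.len_eq] using hl
    · simp [hσ.len_eq]
    · have := hm i
      have := hm' i
      rw [Nat.mul_succ] at *
      omega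
    · rwa [add_comm g, ← add_assoc]
    · have := ho.one_le_v
      simp only [undoCost, List.map_cons, List.sum_cons, Expr.cost]
      omega

/-- The memory while the construction is copied, up to `i`. -/
structure CopyRep (l : List (Merge n)) (m : ZMod n → ℕ) (i : ℕ) (σ : Store) : Prop where
  le : i ≤ n
  n_eq : σ.reg 0 = n
  i_eq : σ.reg 5 = i
  len_eq : σ.reg 4 = l.length
  m_eq : ∀ j : ZMod n, σ.arr 2 j.val = m j
  copy_eq : ∀ j : ZMod n, j.val < i → σ.arr 3 j.val = m j
  log_eq : LogRep σ.arr l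

theorem copy_ends {B : ℕ} (hB : WordBound A B) {l : List (Merge n)} {m : ZMod n → ℕ} {σ : Store}
    (hσ : UndoRep l m { σ with arr := Function.update σ.arr 3 (σ.arr 2) }) (hm : ∀ i, m i < B) :
    Ends B (.seq (.set 5 0) (.loop (.bin .lt (.reg 5) (.reg 0)) copyStep)) σ (30 * n + 30)
      (UndoRep l m) := by
  obtain ⟨b0, b1, b2, b3, b4, b5⟩ := hB.bounds
  have h0 : CopyRep l m 0 (σ.setReg 5 0) := by
    refine ⟨Nat.zero_le _, ?_, ?_, ?_, ?_, fun j hj => absurd hj (by omega),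
      hσ.log_eq.congr fun c hc _ _ => ?_⟩
    · simpa using hσ.n_eq
    · simp
    · simpa using hσ.len_eq
    · intro j; simpa using hσ.m_eq j
    · have : c ≠ 3 := by omega
      simp [this]
  refine Ends.mono (T₁ := (Prog.set 5 0).steps + _) (.seq (.set 0 ?_ ?_
    (.loop (CopyRep l m) (fun i => n - i) copyStep.steps ?_ ?_ 0 h0))) ?_ ?_
  · simp; omega
  · simp
  · intro i σ h
    have := h.le
    simp [Expr.fits_lt (show 1 < B by omega), h.n_eq, h.i_eq]
    omega
  · intro i σ h hi
    have hin : i < n := by simpa [h.n_eq, h.i_eq] using hi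
    have hval : ((i : ℕ) : ZMod n).val = i := ZMod.val_cast_of_lt hin
    have hmi := h.m_eq (i : ZMod n)
    rw [hval] at hmi
    have := hm (i : ZMod n)
    refine Ends.store_seq i (m i) ?_ ?_ ?_ ?_ ?_
    · simp [h.i_eq]; omega
    · simp [h.i_eq, hmi]; omega
    · simp [h.i_eq]
    · simp [h.i_eq, hmi]
    refine Ends.set (i + 1) ?_ ?_ ⟨i + 1, ⟨?_, ?_, ?_, ?_, ?_, ?_, ?_⟩, ?_⟩
    · simp [h.i_eq]; omega
    · simp [h.i_eq]
    · omega
    · simp [h.n_eq]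
    · simp
    · simp [h.len_eq]
    · simpa using h.m_eq
    · intro j hj
      simp only [Store.arr_setReg, Store.arr_setCell, reduceIte, Function.update_apply]
      split_ifs with hji
      · rw [← hji, ZMod.natCast_zmod_val]
      · exact h.copy_eq j (by omega)
    · refine h.log_eq.congr fun c hc _ _ => ?_
      have : c ≠ 3 := by omega
      simp [this]
    · omega
  · have e1 : copyStep.steps + (Expr.bin .lt (.reg 5) (.reg 0)).cost + 1 ≤ 30 := by decide
    have e2 : (Prog.set 5 0).steps + ((Expr.bin .lt (.reg 5) (.reg 0)).cost + 1) ≤ 30 := by decide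
    have := Nat.mul_le_mul_left (n - 0) e1
    omega
  · rintro τ ⟨i, h, hi⟩
    have hin : n ≤ i := by simpa [h.n_eq, h.i_eq] using hi
    exact ⟨h.n_eq, h.len_eq, fun j => h.copy_eq j ((ZMod.val_lt j).trans_le hin), h.log_eq⟩

theorem recovers {B : ℕ} (hB : WordBound A B) {S : State n} (h : S.Inv A) {σ : Store}
    (hσ : Rep A S σ) (hL : ∀ i, S.L i ≤ 3 * (n * n) + A i) :
    Recovers B (3000 * n) recoverProg σ A S.L S.g := by
  obtain ⟨b0, b1, b2, b3, b4, b5⟩ := hB.bounds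
  have hn : 2 ≤ n := (Fact.out : n.Prime).two_le
  obtain ⟨A', hd, hle⟩ := h.derives
  intro m x hx
  have hcost := h.cost_le'
  have hlen := hd.length_le
  have h2 : 2 * n * S.log.length ≤ 2 * n * (5 * n) := Nat.mul_le_mul_left _ (by omega)
  have h2' : 2 * n * (5 * n) = 10 * (n * n) := by ring
  -- Here `3 * (n * n)` comes from the lengths and `10 * (n * n)` from at most `5 * n` merges that
  -- add at most `2 * n` each.
  have hbd : ∀ i, m i + 2 * n * S.log.length ≤ 13 * (n * n) + ∑ i, A i := by
    intro i
    have h3 := hL i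
    have h4 := hx.1 i
    have h5 := Finset.single_le_sum (f := A) (fun _ _ => Nat.zero_le _) (Finset.mem_univ i)
    omega
  have hK : 13 * (n * n) + ∑ i, A i + 2 * n < B := by
    have h1 : n * n * 1 ≤ n * n * n := Nat.mul_le_mul_left _ (by omega)
    have h3 : n ^ 3 = n * n * n := by ring
    unfold WordBound at hB
    omega
  have hx' : IsConstruction A' m x :=
    ⟨fun i => (hx.1 i).trans ((Nat.le_add_right _ _).trans (hle i)), hx.2⟩
  refine Ends.mono (.seq ((copy_ends hB ?_ fun i => ?_).mono le_rfl fun τ hτ =>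
    undo_loop_ends hB hK hd hx' hτ ?_ hbd)) ?_ fun _ h => h
  · refine ⟨hσ.n_eq, hσ.len_eq, fun i => ?_, hσ.log_eq.congr fun c hc _ _ => ?_⟩
    · simp [table_val]
    · have h1 : c ≠ 3 := by omega
      have h2 : c ≠ 2 := by omega
      simp [h1, h2]
  · have := hbd i
    omega
  · omega
  · omega

end APSum
namespace APSum

/-! ### Word size and the final concentration. -/

variable {n : ℕ} [Fact n.Prime] {A : Lengths n}

theorem Concentrated.le_sum {k : ℝ} (h : Concentrated n k A) :
    n ≤ ∑ i, if i = 0 then 0 else A i := by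
  obtain ⟨I, h0, -, hI⟩ := h
  calc n ≤ ∑ i ∈ I, A i := hI
    _ = ∑ i ∈ I, if i = 0 then 0 else A i :=
      Finset.sum_congr rfl fun i hi => by rw [if_neg]; rintro rfl; exact h0 hi
    _ ≤ _ := Finset.sum_le_sum_of_subset (Finset.subset_univ I)

theorem wordBound_pow {C : ℕ} (hC : 10 ≤ C) : WordBound A ((n + ∑ i, A i) ^ C) := by
  have hn : 2 ≤ n := (Fact.out : n.Prime).two_le
  set M := n + ∑ i, A i with hM
  have h2 : 2 ≤ M := by omega
  calc 100 * n ^ 3 + ∑ i, A i ≤ 100 * M ^ 3 + M ^ 3 :=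
        Nat.add_le_add (Nat.mul_le_mul_left _ (Nat.pow_le_pow_left (by omega) _))
          ((show ∑ i, A i ≤ M by omega).trans (Nat.le_self_pow (by omega) _))
    _ < 2 ^ 7 * M ^ 3 := by
        have : 0 < M ^ 3 := by positivity
        omega
    _ ≤ M ^ 7 * M ^ 3 := Nat.mul_le_mul_right _ (Nat.pow_le_pow_left h2 _)
    _ = M ^ 10 := by ring
    _ ≤ M ^ C := Nat.pow_le_pow_right (by omega) hC

theorem State.Inv.reach {S : State n} (h : S.Inv A) : Reach A S.L S.g := by
  obtain ⟨A', hd, hle⟩ := h.derives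
  have := hd.reach.step (.drop S.L fun i => (Nat.le_add_right _ _).trans (hle i))
  rwa [add_zero] at this

theorem concentrated_of_le {i : ZMod n} (h0 : i ≠ 0) (h : n ≤ A i) : Concentrated n n A := by
  have hn : (n : ℝ) ≠ 0 := Nat.cast_ne_zero.mpr (Fact.out : n.Prime).ne_zero
  refine ⟨{i}, by simpa using h0.symm, ?_, by simpa using h⟩
  rw [div_self hn]
  simp

end APSum

theorem mainTheorem5 :
    ∃ (P R : WordRAM.Prog) (C : ℕ),
      ∀ (n : ℕ) [Fact n.Prime] (k : ℝ) (A : APSum.Lengths n),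
        1000 ≤ k → k ^ (4 / 3 : ℝ) ≤ (n : ℝ) → APSum.Concentrated n k A →
        ∃ (σ : WordRAM.Store) (t : ℕ) (A' : APSum.Lengths n) (g : ZMod n),
          WordRAM.Exec ((n + ∑ i, A i) ^ C) P (APSum.inputStore A) σ t ∧ t ≤ C * n ∧
          APSum.Holds σ A' g ∧
          APSum.Reach A A' g ∧
          APSum.Recovers ((n + ∑ i, A i) ^ C) (C * n) R σ A A' g ∧
          ∃ k' : ℝ, k ^ (4 / 3 : ℝ) ≤ k' ∧ APSum.Concentrated n k' A' := by
  -- The constant 3000 bounds both running times and also serves as the exponent of the word size,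
  -- for which 10 would be enough.
  refine ⟨APSum.growProg, APSum.recoverProg, 3000, fun n _ k A _ hk hA => ?_⟩
  have hB : APSum.WordBound A ((n + ∑ i, A i) ^ 3000) := APSum.wordBound_pow (by omega)
  obtain ⟨σ, t, hexec, ht, S, ⟨hI, hσ, hle⟩, hn⟩ := APSum.grow_ends hB hA.le_sum
  have hcur : S.cur ≠ 0 := by
    intro h0
    rw [h0, hI.L_zero] at hn
    exact absurd hn (Nat.not_le.mpr (Fact.out : n.Prime).pos)
  -- The witness for `k'` is `n` itself, so `hk` is the required inequality.
  refine ⟨σ, t, S.L, S.g, hexec, ht, ⟨hσ.L_eq, hσ.g_eq⟩, hI.reach,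
    APSum.recovers hB hI hσ fun i => ?_, n, hk, APSum.concentrated_of_le hcur hn⟩
  by_cases hi : i = S.cur
  · rwa [hi]
  · have h1 := hI.f_lt i
    have h2 := hI.f_eq i hi
    have h3 := Nat.le_mul_self n
    omega
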